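/- **Setting.** A compact nilmanifold is a quotient $M=\Gamma\backslash G$, where $G$ is a connected, simply connected real Lie group with nilpotent Lie algebra $\mathfrak g$ and $\Gamma\subset G$ is a lattice (a discrete subgroup with compact quotient). Write $\mathfrak g_1=\mathfrak g$, $\mathfrak g_{j+1}=[\mathfrak g_j,\mathfrak g]$ for the descending central series and $Z(\mathfrak g)$ for the centre. A *Malcev basis* strongly based at $\Gamma$ is an ordered basis $E_1,\dots,E_n$ of $\mathfrak g$ such that every final segment $E_{l+1},\dots,E_n$ spans a subalgebra, every $\mathfrak g_j$ is spanned by a final segment, and $\Gamma=\{\exp(m_1E_1)\cdots\exp(m_nE_n): m_i\in\mathbb Z\}$. A vector of $\mathfrak g$ is *rational* if it lies in the $\mathbb Q$-span of such a basis; a subspace is rational if it has a basis of rational vectors. For $Z\in Z(\mathfrak g)$, the *rational envelope* $[Z]_\Gamma$ is the smallest rational subspace of $Z(\mathfrak g)$ containing $Z$. If $\mathfrak g$ is nilpotent of step $k\ge 2$, then $(X,Y,Z)\in\mathfrak g^3$ is a *Heisenberg triple* if $Z\in\mathfrak g_k$ and $[X,Y]=Z$. **Towers.** Let $X\in\mathfrak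 g\setminus[\mathfrak g,\mathfrak g]$. A tower $\mathcal T$ of Heisenberg extensions of height $h\ge 0$ for $M$ based at $X$ consists of nilmanifolds $M^{(i)}=\Gamma^{(i)}\backslash G^{(i)}$ and vectors $X^{(i)}\in\mathfrak g^{(i)}$ for $0\le i\le h$, with $M^{(0)}=M$ and $X^{(0)}=X$, and vectors $Y^{(i)},Z^{(i)}\in\mathfrak g^{(i)}$ for $0\le i\le h-1$, such that for every $0\le i\le h-1$: $(X^{(i)},Y^{(i)},Z^{(i)})$ is a Heisenberg triple in $\mathfrak g^{(i)}$; with $\mathfrak z^{(i)}=[Z^{(i)}]_{\Gamma^{(i)}}$ one has $\mathfrak g^{(i+1)}=\mathfrak g^{(i)}/\mathfrak z^{(i)}$, $G^{(i+1)}=G^{(i)}/\exp\mathfrak z^{(i)}$ and $\Gamma^{(i+1)}=\Gamma^{(i)}/(\Gamma^{(i)}\cap\exp\mathfrak z^{(i)})$; and $X^{(i+1)}$ is the projection of $X^{(i)}$. Let $\pi^{(i+1)}:M^{(i)}\to M^{(i+1)}$ be the canonical projection. The tower is *maximal* if $G^{(h)}$ is abelian, so that $M^{(h)}$ is a torus.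 **Trigonometric polynomials.** For a rational subspace $\mathfrak z\subset Z(\mathfrak g)$ let $\Lambda=\{t\in\mathfrak z:\exp t\in\Gamma\}$ and let $\Lambda^*$ be the set of linear forms on $\mathfrak z$ that are integer valued on $\Lambda$. A function $f\in C^0(M)$ (complex valued) is a *trigonometric polynomial with respect to $\mathfrak z$* if there is a finitely supported family of continuous functions $(f_v)_{v\in\Lambda^*}$ (necessarily unique) with $f(x\exp t)=\sum_{v\in\Lambda^*}f_v(x)\,e^{2\pi i\langle v,t\rangle}$ for all $x\in M$, $t\in\mathfrak z$. For a maximal tower $\mathcal T$ let $\mathscr P^{(h)}$ be the space of finite linear combinations of characters of the torus $M^{(h)}$; for $i=h-1,\dots,0$ let $\mathscr P^{(i)}$ be the space of trigonometric polynomials $f$ on $M^{(i)}$ with respect to $\mathfrak z^{(i)}$ whose coefficient $f_0$ is the pull-back by $\pi^{(i+1)}$ of a function in $\mathscr P^{(i+1)}$; and let $\mathscr P_{\mathcal T}=\mathscr P^{(0)}$. **Statement.** Let $M$ be a compact nilmanifold and let $\mathcal T$ be any maximal tower of Heisenberg extensions for $M$ based at a vector $X\in\mathfrak g\setminus[\mathfrak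 g,\mathfrak g]$. Then the smooth functions belonging to $\mathscr P_{\mathcal T}$ are dense in $C^\infty(M)$, for its usual Fréchet topology (uniform convergence of functions together with all their iterated derivatives along left-invariant vector fields): every $f\in C^\infty(M)$ can be approximated arbitrarily well in this topology by elements of $\mathscr P_{\mathcal T}\cap C^\infty(M)$. -/

import Mathlib

open scoped Manifold ContDiff UniformConvergence

universe u

/-- Over `ℝ`, a smooth Lie group is regular enough for its Lie algebra to be defined. -/
instance instLEInftyMinSmoothnessRealThree : ENat.LEInfty (minSmoothness ℝ 3) where
  out := by
    rw [minSmoothness_of_isRCLikeNormedField]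
    exact ENat.LEInfty.out

/-- A compact nilmanifold `Γ \ G`: a connected, simply connected real Lie group `G` whose Lie
algebra is nilpotent, together with a lattice `Γ` in `G`, that is, a discrete subgroup with compact
quotient. -/
structure Nilmanifold where
  /-- the dimension of the group -/
  dim : ℕ
  /-- the Lie group -/
  G : Type u
  [group : Group G]
  [topology : TopologicalSpace G]
  [t2 : T2Space G]
  [charted : ChartedSpace (EuclideanSpace ℝ (Fin dim)) G]
  [lieGroup : LieGroup (𝓡 dim) ∞ G]
  [simplyConnected : SimplyConnectedSpace G]
  [nilpotent : LieRing.IsNilpotent (GroupLieAlgebra (𝓡 dim) G)]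
  /-- the lattice -/
  Γ : Subgroup G
  discrete : DiscreteTopology Γ
  cocompact : CompactSpace (Quotient (QuotientGroup.rightRel Γ))

attribute [instance] Nilmanifold.group Nilmanifold.topology Nilmanifold.t2 Nilmanifold.charted
  Nilmanifold.lieGroup Nilmanifold.simplyConnected Nilmanifold.nilpotent

namespace Nilmanifold

/-- The Lie algebra `𝔤` of the group `G`. -/
abbrev LieAlg (N : Nilmanifold.{u}) : Type := GroupLieAlgebra (𝓡 N.dim) N.G

/-- The underlying space `Γ \ G` of right cosets `Γ g`, with the quotient topology. -/
abbrev Space (N : Nilmanifold.{u}) : Type u := Quotient (QuotientGroup.rightRel N.Γ)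

instance (N : Nilmanifold.{u}) : DiscreteTopology N.Γ := N.discrete

instance (N : Nilmanifold.{u}) : CompactSpace N.Space := N.cocompact

/-- The quotient map `G → Γ \ G`. -/
def toSpace (N : Nilmanifold.{u}) (g : N.G) : N.Space := Quotient.mk (QuotientGroup.rightRel N.Γ) g

/-- The right action of `G` on `Γ \ G`, namely `(Γ x, g) ↦ Γ x g`. -/
def act (N : Nilmanifold.{u}) (x : N.Space) (g : N.G) : N.Space :=
  Quotient.map (fun y : N.G => y * g) (fun a b hab => by
    have h : QuotientGroup.rightRel N.Γ a b := hab
    rw [QuotientGroup.rightRel_apply] at h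
    change QuotientGroup.rightRel N.Γ (a * g) (b * g)
    rw [QuotientGroup.rightRel_apply]
    simpa [mul_assoc] using h) x

open Classical in
/-- The exponential map: `exp X = γ 1`, where `γ` is the integral curve with `γ 0 = 1` of the
left-invariant vector field determined by `X`. Such a curve always exists and is unique; the value
in the other branch is never taken. -/
noncomputable def exp (N : Nilmanifold.{u}) (X : N.LieAlg) : N.G :=
  if h : ∃ γ : ℝ → N.G, γ 0 = 1 ∧
      IsMIntegralCurve (I := 𝓡 N.dim) γ (mulInvariantVectorField (I := 𝓡 N.dim) X)
  then h.choose 1 else 1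

/-- A Malcev basis of `𝔤` through the descending central series and strongly based at `Γ`:
dropping the first `l` vectors leaves a basis of a subalgebra; every term of the descending central
series is spanned by a final segment of the basis; and `Γ` consists exactly of the products
`exp (m₁ E₁) ⋯ exp (mₙ Eₙ)` with integer coefficients. -/
structure IsMalcevBasis (N : Nilmanifold.{u}) (E : Module.Basis (Fin N.dim) ℝ N.LieAlg) :
    Prop where
  subalgebra : ∀ l : ℕ, ∀ V ∈ Submodule.span ℝ (E '' {i | l ≤ (i : ℕ)}),
    ∀ W ∈ Submodule.span ℝ (E '' {i | l ≤ (i : ℕ)}),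
      ⁅V, W⁆ ∈ Submodule.span ℝ (E '' {i | l ≤ (i : ℕ)})
  centralSeries : ∀ j : ℕ, ∃ l : ℕ, Submodule.span ℝ (E '' {i | l ≤ (i : ℕ)}) =
    (LieModule.lowerCentralSeries ℝ N.LieAlg N.LieAlg j).toSubmodule
  lattice : ∀ g : N.G, g ∈ N.Γ ↔
    ∃ m : Fin N.dim → ℤ, g = (List.ofFn fun i => N.exp ((m i : ℝ) • E i)).prod

/-- A vector of `𝔤` is rational (with respect to `Γ`) if it is a combination with rational
coefficients of the vectors of a Malcev basis strongly based at `Γ`. -/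
def IsRational (N : Nilmanifold.{u}) (V : N.LieAlg) : Prop :=
  ∃ E : Module.Basis (Fin N.dim) ℝ N.LieAlg, N.IsMalcevBasis E ∧
    ∃ q : Fin N.dim → ℚ, V = ∑ i, (q i : ℝ) • E i

/-- A subspace of `𝔤` is rational if it is spanned by rational vectors. -/
def IsRationalSubspace (N : Nilmanifold.{u}) (W : Submodule ℝ N.LieAlg) : Prop :=
  ∃ s : Set N.LieAlg, (∀ V ∈ s, N.IsRational V) ∧ Submodule.span ℝ s = W

/-- `z` is the rational envelope `[Z]_Γ` of `Z`: the smallest rational subspace of the centre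
of `𝔤` that contains `Z`. -/
def IsRationalEnvelope (N : Nilmanifold.{u}) (Z : N.LieAlg) (z : Submodule ℝ N.LieAlg) : Prop :=
  IsLeast {W : Submodule ℝ N.LieAlg | N.IsRationalSubspace W ∧
    W ≤ (LieAlgebra.center ℝ N.LieAlg).toSubmodule ∧ Z ∈ W} z

/-- `(X, Y, Z)` is a Heisenberg triple: `𝔤` is nilpotent of some step `k + 1 ≥ 2`, `Z` belongs to
the last nonzero term of the descending central series (`lowerCentralSeries` is indexed from `0`),
and `[X, Y] = Z`. -/
def IsHeisenbergTriple (N : Nilmanifold.{u}) (X Y Z : N.LieAlg) : Prop :=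
  ∃ k : ℕ, 1 ≤ k ∧ LieModule.lowerCentralSeries ℝ N.LieAlg N.LieAlg k ≠ ⊥ ∧
    LieModule.lowerCentralSeries ℝ N.LieAlg N.LieAlg (k + 1) = ⊥ ∧
    Z ∈ LieModule.lowerCentralSeries ℝ N.LieAlg N.LieAlg k ∧ ⁅X, Y⁆ = Z

/-- The derivative at the identity of a homomorphism of Lie groups, as a map of Lie algebras. -/
noncomputable def derivAtOne {N N' : Nilmanifold.{u}} (p : N.G →* N'.G) :
    N.LieAlg →ₗ[ℝ] N'.LieAlg :=
  (mfderiv (𝓡 N.dim) (𝓡 N'.dim) p 1).toLinearMap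

/-- `N'` is the quotient of the nilmanifold `N` by the subspace `z` of the Lie algebra: a smooth
homomorphism `G → G'` which presents `G'` as the Lie group `G / exp z` and its Lie algebra as
`𝔤 / z`, and which maps `Γ` onto `Γ'`. -/
structure Projection (N N' : Nilmanifold.{u}) (z : Submodule ℝ N.LieAlg) where
  /-- the projection of groups -/
  hom : N.G →* N'.G
  smooth : ContMDiff (𝓡 N.dim) (𝓡 N'.dim) ∞ hom
  surjective : Function.Surjective hom
  ker_hom : (hom.ker : Set N.G) = N.exp '' (z : Set N.LieAlg)
  deriv_surjective : Function.Surjective (derivAtOne hom)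
  ker_deriv : LinearMap.ker (derivAtOne hom) = z
  map_lattice : N.Γ.map hom = N'.Γ

/-- The canonical projection `Γ \ G → Γ' \ G'` of nilmanifolds. -/
def Projection.toMap {N N' : Nilmanifold.{u}} {z : Submodule ℝ N.LieAlg}
    (p : Projection N N' z) : C(N.Space, N'.Space) where
  toFun := Quotient.map p.hom (fun a b hab => by
    have h : QuotientGroup.rightRel N.Γ a b := hab
    rw [QuotientGroup.rightRel_apply] at h
    change QuotientGroup.rightRel N'.Γ (p.hom a) (p.hom b)
    rw [QuotientGroup.rightRel_apply, ← p.map_lattice, ← map_inv, ← map_mul]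
    exact Subgroup.mem_map_of_mem p.hom h)
  continuous_toFun := p.smooth.continuous.quotient_map' _

/-- For a subspace `z` of `𝔤`, the dual `Λ*` of `Λ = {t ∈ z | exp t ∈ Γ}`: the linear forms on `z`
that take integer values on `Λ`. -/
def dualLattice (N : Nilmanifold.{u}) (z : Submodule ℝ N.LieAlg) :
    AddSubgroup (Module.Dual ℝ z) where
  carrier := {v | ∀ t : z, N.exp (t : N.LieAlg) ∈ N.Γ → ∃ n : ℤ, v t = n}
  zero_mem' := fun _ _ => ⟨0, by simp⟩
  add_mem' := by
    intro v w hv hw t ht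
    obtain ⟨a, ha⟩ := hv t ht
    obtain ⟨b, hb⟩ := hw t ht
    exact ⟨a + b, by simp [ha, hb]⟩
  neg_mem' := by
    intro v hv t ht
    obtain ⟨a, ha⟩ := hv t ht
    exact ⟨-a, by simp [ha]⟩

/-- `f` is a trigonometric polynomial with respect to `z`, with constant coefficient `f₀`: there is
a finitely supported family of continuous functions `f_v`, `v ∈ Λ*`, whose member at `v = 0` is
`f₀`, with `f (x exp t) = ∑ f_v (x) e^{2πi⟨v, t⟩}` for all `x ∈ Γ \ G` and `t ∈ z`. (The family is
determined by `f`.) -/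
def IsRelTrigPoly (N : Nilmanifold.{u}) (z : Submodule ℝ N.LieAlg) (f f₀ : C(N.Space, ℂ)) : Prop :=
  ∃ c : N.dualLattice z →₀ C(N.Space, ℂ), c 0 = f₀ ∧
    ∀ (x : N.Space) (t : z), f (N.act x (N.exp (t : N.LieAlg))) =
      c.sum fun v cv =>
        cv x * Complex.exp (2 * Real.pi * Complex.I * (((v : Module.Dual ℝ z) t : ℝ) : ℂ))

/-- The trigonometric polynomials on `Γ \ G` when this is a torus (`G` abelian): the finite linear
combinations of characters. -/
def torusTrigPoly (N : Nilmanifold.{u}) : Set C(N.Space, ℂ) :=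
  Submodule.span ℂ {e : C(N.Space, ℂ) | ∃ χ : N.G →ₜ* Circle, ∀ g : N.G, e (N.toSpace g) = χ g}

/-- The space `C^∞(Γ \ G)` of complex-valued smooth functions. Since `G → Γ \ G` is a smooth
covering, smoothness is tested on the lift to `G`. -/
def SmoothFunction (N : Nilmanifold.{u}) : Type u :=
  {f : C(N.Space, ℂ) // ContMDiff (𝓡 N.dim) 𝓘(ℝ, ℂ) ∞ fun g : N.G => f (N.toSpace g)}

/-- The derivative `V₁ (V₂ (⋯ F))` of a function `F` on `G` along a list of left-invariant vector
fields. -/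
noncomputable def iterDeriv (N : Nilmanifold.{u}) : List N.LieAlg → (N.G → ℂ) → N.G → ℂ
  | [], F => F
  | V :: l, F => fun g =>
      mfderiv (𝓡 N.dim) 𝓘(ℝ, ℂ) (iterDeriv N l F) g (mulInvariantVectorField (I := 𝓡 N.dim) V g)

/-- The topology of `C^∞(Γ \ G)`: uniform convergence of the functions and of all their iterated
derivatives along left-invariant vector fields, which form a global frame of `Γ \ G`. This is the
usual Fréchet topology, generated by the `C^k` norms for all `k`. -/
noncomputable instance (N : Nilmanifold.{u}) : TopologicalSpace N.SmoothFunction :=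
  ⨅ l : List N.LieAlg, TopologicalSpace.induced
    (fun f : N.SmoothFunction => UniformFun.ofFun (N.iterDeriv l fun g => f.1 (N.toSpace g)))
    (inferInstance : TopologicalSpace (N.G →ᵤ ℂ))

end Nilmanifold

/-- A tower of Heisenberg extensions of height `h` for `N` based at `X`: a chain
`N = N⁽⁰⁾ → N⁽¹⁾ → ⋯ → N⁽ʰ⁾` of nilmanifolds with vectors `X⁽ⁱ⁾`, and `Y⁽ⁱ⁾`, `Z⁽ⁱ⁾` for `i < h`, such
that for `i < h` the triple `(X⁽ⁱ⁾, Y⁽ⁱ⁾, Z⁽ⁱ⁾)` is a Heisenberg triple, `N⁽ⁱ⁺¹⁾` is the quotient of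
`N⁽ⁱ⁾` by the rational envelope `z⁽ⁱ⁾` of `Z⁽ⁱ⁾`, and `X⁽ⁱ⁺¹⁾` is the projection of `X⁽ⁱ⁾`. -/
inductive HeisenbergTower : (N : Nilmanifold.{u}) → N.LieAlg → ℕ → Type (u + 1)
  | base (N : Nilmanifold.{u}) (X : N.LieAlg) : HeisenbergTower N X 0
  | step {N N' : Nilmanifold.{u}} {X : N.LieAlg} (Y Z : N.LieAlg) (z : Submodule ℝ N.LieAlg)
      (triple : N.IsHeisenbergTriple X Y Z) (envelope : N.IsRationalEnvelope Z z)
      (p : Nilmanifold.Projection N N' z) {h : ℕ}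
      (T : HeisenbergTower N' (Nilmanifold.derivAtOne p.hom X) h) : HeisenbergTower N X (h + 1)

namespace HeisenbergTower

/-- A tower is maximal if the last group `G⁽ʰ⁾` is abelian (so that `N⁽ʰ⁾` is a torus). -/
def IsMaximal : {N : Nilmanifold.{u}} → {X : N.LieAlg} → {h : ℕ} → HeisenbergTower N X h → Prop
  | _, _, _, base N _ => ∀ a b : N.G, a * b = b * a
  | _, _, _, step _ _ _ _ _ _ T => IsMaximal T

/-- The space `𝒫` of trigonometric polynomials with respect to a (maximal) tower: at the last level
the trigonometric polynomials on the torus `N⁽ʰ⁾`; at a level `i < h` the trigonometric polynomials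
with respect to `z⁽ⁱ⁾` whose constant coefficient is the pull-back of a trigonometric polynomial
with respect to the rest of the tower. -/
def trigPoly : {N : Nilmanifold.{u}} → {X : N.LieAlg} → {h : ℕ} → HeisenbergTower N X h →
    Set C(N.Space, ℂ)
  | _, _, _, base N _ => N.torusTrigPoly
  | _, _, _, step (N := N) _ _ z _ _ p T =>
      {f | ∃ φ ∈ trigPoly T, N.IsRelTrigPoly z f (φ.comp p.toMap)}

end HeisenbergTower

/-!
The argument is an induction along the tower, and it uses only that each `z` is central and that the
next nilmanifold is the quotient by `exp z`.

Let `z` be a central subspace of `𝔤`. A central vector is bi-invariant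
(`isBiInvariant_of_leftBracket_eq_zero`): the derivative of `g ↦ Ad g V` is given by brackets with
`V`, so the stabilizer of `V` is an open subgroup of the connected group `G`. Therefore `exp` is a
homomorphism from `z` to the centre of `G` (`IsExponential.add`, `IsExponential.mul_comm`), and `z`
acts on `Γ \ G` by right translations. Since `Γ exp z` is the preimage of the discrete group `Γ'`,
it is closed, and the lattice `Λ = {t ∈ z | exp t ∈ Γ}` is cocompact in `z`
(`Projection.exists_relativelyDense`), so that the action factors through the torus `z / Λ`.

Averages of the translates of a smooth function by elements of the torus, weighted by a continuous
function `χ`, are smooth, and averaging commutes with all left-invariant derivatives because the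
translations are central (`leftDeriv_integral`, `CentralFamily.smoothIterDeriv_smoothAvg`). Taking
for `χ` a trigonometric polynomial close to an approximate identity, a smooth function `f` and any
finite number of its derivatives are approximated uniformly by a finite sum of smooth functions
`c_v`, where `c_v` is multiplied by `e^{2πi⟨v, t⟩}` under translation by `exp t`
(`exists_weight_decomposition`).

The function `c_0` is invariant under `exp z`, so it descends to the quotient, smoothly because the
projection has smooth local sections (`Projection.exists_pullback_eq`). There it is approximated by
the induction hypothesis, and left-invariant derivatives are compatible with the pull-back
(`SmoothlyDense.of_projection`). At the top of the tower `G` is abelian, all vectors are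
bi-invariant, and the same decomposition with `z = 𝔤` consists of multiples of characters because
`exp` is onto (`HasWeight.mem_torusTrigPoly`).

Tangent spaces are identified with the model space throughout, which is also the underlying space of
the Lie algebra. Calculus on `G` is done in the left translates of the preferred chart at the
identity.
-/

/-! ### Derivatives as maps of model spaces -/

section TangentMap

variable (E E' E'' : Type*) [NormedAddCommGroup E] [NormedSpace ℝ E]
  [NormedAddCommGroup E'] [NormedSpace ℝ E'] [NormedAddCommGroup E''] [NormedSpace ℝ E'']
  {M : Type*} [TopologicalSpace M] [ChartedSpace E M]
  {M' : Type*} [TopologicalSpace M'] [ChartedSpace E' M']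
  {M'' : Type*} [TopologicalSpace M''] [ChartedSpace E'' M'']

/-- The manifold derivative, regarded as a map of the model spaces. All tangent spaces of a manifold
being copies of its model space, this removes the dependence of the type on the base point. -/
noncomputable def modelDeriv (f : M → M') (x : M) : E →L[ℝ] E' :=
  mfderiv 𝓘(ℝ, E) 𝓘(ℝ, E') f x

variable {E E' E''}

theorem hasMFDerivAt_modelDeriv {f : M → M'} {x : M}
    (hf : MDifferentiableAt 𝓘(ℝ, E) 𝓘(ℝ, E') f x) :
    HasMFDerivAt 𝓘(ℝ, E) 𝓘(ℝ, E') f x (modelDeriv E E' f x) :=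
  hf.hasMFDerivAt

theorem modelDeriv_eq {f : M → M'} {x : M} {L : E →L[ℝ] E'}
    (hf : HasMFDerivAt 𝓘(ℝ, E) 𝓘(ℝ, E') f x L) : modelDeriv E E' f x = L :=
  hf.mfderiv

theorem modelDeriv_comp {g : M' → M''} {f : M → M'} {x : M} {y : M'} (hxy : f x = y)
    (hg : MDifferentiableAt 𝓘(ℝ, E') 𝓘(ℝ, E'') g y)
    (hf : MDifferentiableAt 𝓘(ℝ, E) 𝓘(ℝ, E') f x) :
    modelDeriv E E'' (fun z => g (f z)) x =
      (modelDeriv E' E'' g y).comp (modelDeriv E E' f x) := by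
  subst hxy
  exact modelDeriv_eq ((hasMFDerivAt_modelDeriv hg).comp x (hasMFDerivAt_modelDeriv hf))

theorem modelDeriv_eq_fderiv (f : E → E') (x : E) : modelDeriv E E' f x = fderiv ℝ f x :=
  mfderiv_eq_fderiv

theorem Filter.EventuallyEq.modelDeriv_eq {f g : M → M'} {x : M} (h : f =ᶠ[nhds x] g) :
    modelDeriv E E' f x = modelDeriv E E' g x :=
  h.mfderiv_eq

end TangentMap

/-! ### Flows of left-invariant and of bi-invariant vector fields -/

section IntegralCurves

variable {E : Type*} [NormedAddCommGroup E] [NormedSpace ℝ E]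
  {G : Type*} [TopologicalSpace G] [ChartedSpace E G] [Group G]

/-- The value at `g` of the left-invariant vector field determined by `V`, regarded as an element of
the model space. -/
noncomputable def leftField (V : E) (g : G) : E := modelDeriv E E (g * ·) (1 : G) V

/-- A vector of the Lie algebra is bi-invariant if the left-invariant and the right-invariant vector
fields that it determines agree, that is, if it is fixed by the adjoint representation. -/
def IsBiInvariant (G : Type*) [TopologicalSpace G] [ChartedSpace E G] [Group G] (V : E) : Prop :=
  ∀ g : G, modelDeriv E E (· * g) (1 : G) V = leftField V g

/-- `γ` is an integral curve of the left-invariant vector field determined by `V`. -/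
def IsLeftCurve (V : E) (γ : ℝ → G) : Prop :=
  ∀ t, HasMFDerivAt 𝓘(ℝ, ℝ) 𝓘(ℝ, E) γ t
    ((1 : ℝ →L[ℝ] ℝ).smulRight (leftField V (γ t)) : ℝ →L[ℝ] E)

theorem isLeftCurve_iff {V : GroupLieAlgebra 𝓘(ℝ, E) G} {γ : ℝ → G} :
    IsLeftCurve (E := E) V γ ↔ IsMIntegralCurve γ (mulInvariantVectorField (I := 𝓘(ℝ, E)) V) :=
  Iff.rfl

theorem IsLeftCurve.comp_mul {V : E} {γ : ℝ → G} (hγ : IsLeftCurve V γ) (a : ℝ) :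
    IsLeftCurve (a • V) (fun t => γ (t * a)) := by
  have h := IsMIntegralCurve.comp_mul (isLeftCurve_iff.1 hγ) a
  intro t
  have e : leftField (a • V) (γ (t * a)) = a • leftField V (γ (t * a)) := by simp [leftField]
  rw [e]
  exact h t

variable [LieGroup 𝓘(ℝ, E) ∞ G]

theorem mdiffAt_mul_left (g h : G) :
    MDifferentiableAt 𝓘(ℝ, E) 𝓘(ℝ, E) (g * ·) h :=
  (contMDiff_mul_left (I := 𝓘(ℝ, E)) (n := ∞) (a := g)).mdifferentiable (by simp) h

theorem mdiffAt_mul_right (g h : G) :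
    MDifferentiableAt 𝓘(ℝ, E) 𝓘(ℝ, E) (· * g) h :=
  (contMDiff_mul_right (I := 𝓘(ℝ, E)) (n := ∞) (a := g)).mdifferentiable (by simp) h

theorem modelDeriv_mul_left_leftField (g h : G) (V : E) :
    modelDeriv E E (g * ·) h (leftField V h) = leftField V (g * h) := by
  have h3 := modelDeriv_comp (mul_one h) (mdiffAt_mul_left (E := E) g h)
    (mdiffAt_mul_left (E := E) h 1)
  simp only [← mul_assoc] at h3
  simp only [leftField, h3, ContinuousLinearMap.comp_apply]

theorem IsBiInvariant.modelDeriv_mul_right {V : E} (hV : IsBiInvariant G V) (g h : G) :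
    modelDeriv E E (· * g) h (leftField V h) = leftField V (h * g) := by
  have h3 := modelDeriv_comp (mul_one h) (mdiffAt_mul_right (E := E) g h)
    (mdiffAt_mul_left (E := E) h 1)
  have k3 := modelDeriv_comp (f := (· * g)) (one_mul g) (mdiffAt_mul_left (E := E) h g)
    (mdiffAt_mul_right (E := E) g 1)
  simp only [← mul_assoc] at k3
  rw [k3] at h3
  have h5 := congrArg (fun L => L V) h3
  simp only [ContinuousLinearMap.comp_apply] at h5
  rw [hV g, modelDeriv_mul_left_leftField] at h5
  exact h5.symm

theorem contMDiff_one_mulInvariantVectorField (V : GroupLieAlgebra 𝓘(ℝ, E) G) :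
    ContMDiff 𝓘(ℝ, E) 𝓘(ℝ, E).tangent 1
      (fun g : G => (⟨g, mulInvariantVectorField V g⟩ : TangentBundle 𝓘(ℝ, E) G)) :=
  (contMDiff_mulInvariantVectorField V).of_le
    ((by norm_num : (1 : WithTop ℕ∞) ≤ 2).trans le_minSmoothness)

theorem isMIntegralCurveOn_mul_left {V : E} {γ : ℝ → G} {s : Set ℝ}
    (hγ : IsMIntegralCurveOn γ (mulInvariantVectorField (I := 𝓘(ℝ, E)) (G := G) V) s) (g : G) :
    IsMIntegralCurveOn (fun t => g * γ t)
      (mulInvariantVectorField (I := 𝓘(ℝ, E)) (G := G) V) s := by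
  intro t ht
  have h := (hasMFDerivAt_modelDeriv
    (mdiffAt_mul_left (E := E) g (γ t))).comp_hasMFDerivWithinAt t (hγ t ht)
  have e : (modelDeriv E E (g * ·) (γ t)).comp
      ((1 : ℝ →L[ℝ] ℝ).smulRight (leftField V (γ t)) : ℝ →L[ℝ] E) =
      ((1 : ℝ →L[ℝ] ℝ).smulRight (leftField V (g * γ t)) : ℝ →L[ℝ] E) := by
    ext
    simp [modelDeriv_mul_left_leftField]
  exact h.congr_mfderiv e

/-- Left translates of integral curves of a left-invariant field are again integral curves. -/
theorem IsLeftCurve.mul_left {V : E} {γ : ℝ → G} (hγ : IsLeftCurve V γ) (g : G) :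
    IsLeftCurve V (fun t => g * γ t) := by
  have h : IsMIntegralCurve γ (mulInvariantVectorField (I := 𝓘(ℝ, E))
    (V : GroupLieAlgebra 𝓘(ℝ, E) G)) := hγ
  rw [isMIntegralCurve_iff_isMIntegralCurveOn] at h
  exact isMIntegralCurve_iff_isMIntegralCurveOn.2 (isMIntegralCurveOn_mul_left h g)

/-- Right translates of the flow of a bi-invariant vector are again integral curves. -/
theorem IsBiInvariant.isLeftCurve_mul_right {V : E} (hV : IsBiInvariant G V) {γ : ℝ → G}
    (hγ : IsLeftCurve V γ) (g : G) : IsLeftCurve V (fun t => γ t * g) := by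
  intro t
  have h := (hasMFDerivAt_modelDeriv (mdiffAt_mul_right (E := E) g (γ t))).comp t (hγ t)
  have e : (modelDeriv E E (· * g) (γ t)).comp
      ((1 : ℝ →L[ℝ] ℝ).smulRight (leftField V (γ t)) : ℝ →L[ℝ] E) =
      ((1 : ℝ →L[ℝ] ℝ).smulRight (leftField V (γ t * g)) : ℝ →L[ℝ] E) := by
    ext
    simp [hV.modelDeriv_mul_right]
  exact h.congr_mfderiv e

/-- The product of the flows of `V` and of a bi-invariant `W` is the flow of `W + V`. -/
theorem IsBiInvariant.isLeftCurve_mul {V W : E} (hW : IsBiInvariant G W) {γ δ : ℝ → G}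
    (hγ : IsLeftCurve V γ) (hδ : IsLeftCurve W δ) :
    IsLeftCurve (W + V) (fun t => δ t * γ t) := by
  intro t
  have hm : MDifferentiableAt (𝓘(ℝ, E).prod 𝓘(ℝ, E)) 𝓘(ℝ, E) (fun p : G × G => p.1 * p.2)
      (δ t, γ t) := (contMDiff_mul 𝓘(ℝ, E) ∞).mdifferentiable (by simp) _
  refine (hm.hasMFDerivAt.comp t ((hδ t).prodMk (hγ t))).congr_mfderiv ?_
  refine ContinuousLinearMap.ext_ring ?_
  refine (mfderiv_prod_eq_add_apply hm).trans ?_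
  have e1 := hW.modelDeriv_mul_right (γ t) (δ t)
  have e2 := modelDeriv_mul_left_leftField (E := E) (δ t) (γ t) V
  have e3 : leftField (W + V) (δ t * γ t) = leftField W (δ t * γ t) + leftField V (δ t * γ t) := by
    simp [leftField]
  change modelDeriv E E (· * γ t) (δ t) ((1 : ℝ) • leftField W (δ t)) +
    modelDeriv E E (δ t * ·) (γ t) ((1 : ℝ) • leftField V (γ t)) =
    (1 : ℝ) • leftField (W + V) (δ t * γ t)
  rw [one_smul, one_smul, one_smul, e1, e2, e3]

variable [T2Space G]

theorem IsLeftCurve.eq {V : E} {γ γ' : ℝ → G} (hγ : IsLeftCurve V γ) (hγ' : IsLeftCurve V γ')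
    (h : γ 0 = γ' 0) : γ = γ' := by
  have : IsManifold 𝓘(ℝ, E) 1 G := IsManifold.of_le (n := ∞) (by simp)
  exact isMIntegralCurve_Ioo_eq_of_contMDiff_boundaryless
    (contMDiff_one_mulInvariantVectorField (G := G) V) hγ hγ' h

/-- The flow of a bi-invariant vector consists of central elements. -/
theorem IsBiInvariant.curve_mul_comm {V : E} (hV : IsBiInvariant G V) {γ : ℝ → G} (h0 : γ 0 = 1)
    (hγ : IsLeftCurve V γ) (g : G) (t : ℝ) : γ t * g = g * γ t :=
  congrFun ((hV.isLeftCurve_mul_right hγ g).eq (hγ.mul_left g) (by simp [h0])) t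

/-- Left-invariant vector fields are complete. -/
theorem exists_isLeftCurve (G : Type*) [TopologicalSpace G] [ChartedSpace E G] [Group G]
    [LieGroup 𝓘(ℝ, E) ∞ G] [T2Space G] [CompleteSpace E] (V : E) :
    ∃ γ : ℝ → G, γ 0 = 1 ∧ IsLeftCurve V γ := by
  have : IsManifold 𝓘(ℝ, E) 1 G := IsManifold.of_le (n := ∞) (by simp)
  have hV := contMDiff_one_mulInvariantVectorField (G := G) V
  obtain ⟨γ, h0, hγ⟩ := exists_isMIntegralCurveAt_of_contMDiffAt_boundaryless (t₀ := 0)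
    (hV.contMDiffAt (x := (1 : G)))
  obtain ⟨s, hs, hγs⟩ := isMIntegralCurveAt_iff.1 hγ
  obtain ⟨ε, hε, hεs⟩ := Metric.mem_nhds_iff.1 hs
  refine exists_isMIntegralCurve_of_isMIntegralCurveOn hV hε (fun x => ?_) 1
  refine ⟨fun t => x * γ t, by simp [h0], isMIntegralCurveOn_mul_left (hγs.mono ?_) x⟩
  rwa [Real.ball_eq_Ioo, zero_sub, zero_add] at hεs

end IntegralCurves

/-! ### The group law in the chart at the identity -/

section UnitChart

open Filter Topology

variable {E : Type*} [NormedAddCommGroup E] [NormedSpace ℝ E]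
  {G : Type*} [TopologicalSpace G] [ChartedSpace E G] [Group G]

variable (E) in
/-- The preferred chart at the identity. -/
noncomputable def unitChart (g : G) : E := extChartAt 𝓘(ℝ, E) (1 : G) g

variable (G) in
/-- The inverse of the preferred chart at the identity. -/
noncomputable def unitChartSymm (v : E) : G := (extChartAt 𝓘(ℝ, E) (1 : G)).symm v

variable (E G) in
/-- The coordinates of the identity in its preferred chart. -/
noncomputable def unitCoord : E := unitChart E (1 : G)

variable (E G) in
/-- The image of the preferred chart at the identity. -/
def unitTarget : Set E := (extChartAt 𝓘(ℝ, E) (1 : G)).target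

theorem isOpen_unitTarget : IsOpen (unitTarget E G) := isOpen_extChartAt_target (1 : G)

theorem unitCoord_mem : unitCoord E G ∈ unitTarget E G := mem_extChartAt_target (1 : G)

theorem unitTarget_mem_nhds : unitTarget E G ∈ 𝓝 (unitCoord E G) :=
  isOpen_unitTarget.mem_nhds unitCoord_mem

@[simp] theorem unitChartSymm_unitCoord : unitChartSymm G (unitCoord E G) = 1 :=
  extChartAt_to_inv (I := 𝓘(ℝ, E)) (1 : G)

theorem unitChart_unitChartSymm {x : E} (hx : x ∈ unitTarget E G) :
    unitChart E (unitChartSymm G x) = x :=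
  (extChartAt 𝓘(ℝ, E) (1 : G)).right_inv hx

theorem eventually_unitChartSymm_unitChart {x : E} (hx : x ∈ unitTarget E G) :
    ∀ᶠ g in 𝓝 (unitChartSymm G x), unitChartSymm G (unitChart E g) = g := by
  filter_upwards [(isOpen_extChartAt_source (I := 𝓘(ℝ, E)) (1 : G)).mem_nhds
    ((extChartAt 𝓘(ℝ, E) (1 : G)).map_target hx)] with g hg
  exact (extChartAt 𝓘(ℝ, E) (1 : G)).left_inv hg

variable (G) in
/-- The group law in the preferred chart at the identity. -/
noncomputable def localMul (x y : E) : E := unitChart E (unitChartSymm G x * unitChartSymm G y)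

theorem localMul_unitCoord {x : E} (hx : x ∈ unitTarget E G) :
    localMul G x (unitCoord E G) = x := by
  simp [localMul, unitChart_unitChartSymm hx]

theorem unitCoord_localMul {x : E} (hx : x ∈ unitTarget E G) :
    localMul G (unitCoord E G) x = x := by
  simp [localMul, unitChart_unitChartSymm hx]

variable (G) in
/-- The left-invariant frame in the preferred chart at the identity. -/
noncomputable def localFrame (x : E) : E →L[ℝ] E := fderiv ℝ (localMul G x) (unitCoord E G)

theorem localFrame_unitCoord : localFrame G (unitCoord E G) = ContinuousLinearMap.id ℝ E := by
  have e : localMul G (unitCoord E G) =ᶠ[𝓝 (unitCoord E G)] id := by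
    filter_upwards [unitTarget_mem_nhds] with x hx using unitCoord_localMul hx
  rw [localFrame, e.fderiv_eq, fderiv_id]

variable [LieGroup 𝓘(ℝ, E) ∞ G]

theorem contMDiffAt_unitChartSymm {x : E} (hx : x ∈ unitTarget E G) :
    ContMDiffAt 𝓘(ℝ, E) 𝓘(ℝ, E) ∞ (unitChartSymm G) x :=
  (contMDiffOn_extChartAt_symm (1 : G)).contMDiffAt (isOpen_unitTarget.mem_nhds hx)

theorem contMDiffAt_unitChart {x : E} (hx : x ∈ unitTarget E G) :
    ContMDiffAt 𝓘(ℝ, E) 𝓘(ℝ, E) ∞ (unitChart E) (unitChartSymm G x) :=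
  contMDiffAt_extChartAt' (by
    have := (extChartAt 𝓘(ℝ, E) (1 : G)).map_target hx
    rwa [extChartAt_source] at this)

theorem contMDiffAt_unitChart_one : ContMDiffAt 𝓘(ℝ, E) 𝓘(ℝ, E) ∞ (unitChart E) (1 : G) := by
  simpa using contMDiffAt_unitChart (unitCoord_mem (E := E) (G := G))

theorem continuousAt_unitChartSymm {x : E} (hx : x ∈ unitTarget E G) :
    ContinuousAt (unitChartSymm G) x := (contMDiffAt_unitChartSymm hx).continuousAt

theorem modelDeriv_unitChart_one : modelDeriv E E (unitChart E) (1 : G) =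
    ContinuousLinearMap.id ℝ E := by
  ext v
  have h := mfderiv_chartAt_eq_tangentCoordChange (I := 𝓘(ℝ, E)) (mem_chart_source E (1 : G))
  refine (congrArg (fun L : E →L[ℝ] E => L v) h).trans ?_
  exact tangentCoordChange_self (I := 𝓘(ℝ, E)) (mem_extChartAt_source (1 : G))

theorem modelDeriv_unitChartSymm_unitCoord :
    modelDeriv E E (unitChartSymm G) (unitCoord E G) = ContinuousLinearMap.id ℝ E := by
  have h := modelDeriv_comp (unitChartSymm_unitCoord (E := E) (G := G))
    (contMDiffAt_unitChart_one.mdifferentiableAt (by simp))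
    ((contMDiffAt_unitChartSymm unitCoord_mem).mdifferentiableAt (by simp))
  have e : (fun z => unitChart E (unitChartSymm G z)) =ᶠ[𝓝 (unitCoord E G)] id := by
    filter_upwards [unitTarget_mem_nhds] with x hx using unitChart_unitChartSymm hx
  rw [e.modelDeriv_eq, modelDeriv_unitChart_one, modelDeriv_eq_fderiv, fderiv_id] at h
  simpa using h.symm

/-- Left-invariant derivatives can be computed in the chart that is the left translate of the
preferred chart at the identity. -/
theorem modelDeriv_mul_unitChartSymm {E' M' : Type*} [NormedAddCommGroup E'] [NormedSpace ℝ E']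
    [TopologicalSpace M'] [ChartedSpace E' M'] {h : G → M'} {g : G}
    (hh : MDifferentiableAt 𝓘(ℝ, E) 𝓘(ℝ, E') h g) (V : E) :
    modelDeriv E E' (fun v => h (g * unitChartSymm G v)) (unitCoord E G) V =
      modelDeriv E E' h g (leftField V g) := by
  have h1 := modelDeriv_comp (unitChartSymm_unitCoord (E := E) (G := G))
    (mdiffAt_mul_left (E := E) g 1)
    ((contMDiffAt_unitChartSymm unitCoord_mem).mdifferentiableAt (by simp))
  have h2 := modelDeriv_comp (f := fun v => g * unitChartSymm G v) (x := unitCoord E G) (by simp) hh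
    ((mdiffAt_mul_left (E := E) g _).comp _
      ((contMDiffAt_unitChartSymm unitCoord_mem).mdifferentiableAt (by simp)))
  rw [h2, h1, modelDeriv_unitChartSymm_unitCoord]
  rfl

theorem contMDiffAt_mul_unitChartSymm {x y : E} (hx : x ∈ unitTarget E G)
    (hy : y ∈ unitTarget E G) : ContMDiffAt (𝓘(ℝ, E × E)) 𝓘(ℝ, E) ∞
      (fun p : E × E => unitChartSymm G p.1 * unitChartSymm G p.2) (x, y) := by
  have h1 : ContMDiffAt 𝓘(ℝ, E × E) 𝓘(ℝ, E) ∞ (fun p : E × E => unitChartSymm G p.1) (x, y) :=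
    (contMDiffAt_unitChartSymm hx).comp (x, y) contDiff_fst.contMDiff.contMDiffAt
  have h2 : ContMDiffAt 𝓘(ℝ, E × E) 𝓘(ℝ, E) ∞ (fun p : E × E => unitChartSymm G p.2) (x, y) :=
    (contMDiffAt_unitChartSymm hy).comp (x, y) contDiff_snd.contMDiff.contMDiffAt
  exact h1.mul h2

theorem contDiffAt_localMul {x y : E} (hx : x ∈ unitTarget E G) (hy : y ∈ unitTarget E G) {z : E}
    (hz : z ∈ unitTarget E G) (h : unitChartSymm G x * unitChartSymm G y = unitChartSymm G z) :
    ContDiffAt ℝ ∞ (Function.uncurry (localMul G)) (x, y) := by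
  rw [← contMDiffAt_iff_contDiffAt]
  refine ContMDiffAt.comp (x, y) (g := unitChart E)
    (f := fun p : E × E => unitChartSymm G p.1 * unitChartSymm G p.2) ?_
    (contMDiffAt_mul_unitChartSymm hx hy)
  rw [h]
  exact contMDiffAt_unitChart hz

theorem contDiffAt_localMul_left {x : E} (hx : x ∈ unitTarget E G) :
    ContDiffAt ℝ ∞ (Function.uncurry (localMul G)) (x, unitCoord E G) :=
  contDiffAt_localMul hx unitCoord_mem hx (by simp)

theorem contDiffAt_localMul_right {x : E} (hx : x ∈ unitTarget E G) :
    ContDiffAt ℝ ∞ (Function.uncurry (localMul G)) (unitCoord E G, x) :=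
  contDiffAt_localMul unitCoord_mem hx hx (by simp)

theorem eventually_unitChartSymm_localMul {x : E} (hx : x ∈ unitTarget E G) :
    ∀ᶠ v in 𝓝 (unitCoord E G),
      unitChartSymm G (localMul G x v) = unitChartSymm G x * unitChartSymm G v := by
  have h : Tendsto (fun v => unitChartSymm G x * unitChartSymm G v) (𝓝 (unitCoord E G))
      (𝓝 (unitChartSymm G x)) := by
    have : ContinuousMul G := continuousMul_of_contMDiffMul 𝓘(ℝ, E) ∞
    have h1 := (continuousAt_unitChartSymm (unitCoord_mem (E := E) (G := G))).tendsto.const_mul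
      (unitChartSymm G x)
    simpa using h1
  exact h.eventually (eventually_unitChartSymm_unitChart hx)

theorem contDiffAt_localFrame {x : E} (hx : x ∈ unitTarget E G) :
    ContDiffAt ℝ ∞ (localFrame G) x :=
  (contDiffAt_localMul_left hx).fderiv (g := fun _ => unitCoord E G) contDiffAt_const (by simp)

/-- `localFrame` represents the left-invariant vector fields in every left translate of the
preferred chart at the identity. -/
theorem modelDeriv_localFrame {E' M' : Type*} [NormedAddCommGroup E'] [NormedSpace ℝ E']
    [TopologicalSpace M'] [ChartedSpace E' M'] {h : G → M'} {g : G} {x : E}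
    (hx : x ∈ unitTarget E G)
    (hh : MDifferentiableAt 𝓘(ℝ, E) 𝓘(ℝ, E') h (g * unitChartSymm G x)) (V : E) :
    modelDeriv E E' (fun v => h (g * unitChartSymm G v)) x (localFrame G x V) =
      modelDeriv E E' h (g * unitChartSymm G x) (leftField V (g * unitChartSymm G x)) := by
  rw [← modelDeriv_mul_unitChartSymm hh]
  have e : (fun v => h (g * unitChartSymm G (localMul G x v))) =ᶠ[𝓝 (unitCoord E G)]
      (fun v => h (g * unitChartSymm G x * unitChartSymm G v)) := by
    filter_upwards [eventually_unitChartSymm_localMul hx] with v hv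
    rw [hv, mul_assoc]
  rw [← e.modelDeriv_eq]
  have h1 : MDifferentiableAt 𝓘(ℝ, E) 𝓘(ℝ, E') (fun v => h (g * unitChartSymm G v)) x :=
    hh.comp x ((mdiffAt_mul_left (E := E) g _).comp _
      ((contMDiffAt_unitChartSymm hx).mdifferentiableAt (by simp)))
  have h2 : DifferentiableAt ℝ (localMul G x) (unitCoord E G) :=
    ((contDiffAt_localMul_left hx).comp (unitCoord E G)
      (contDiffAt_const.prodMk contDiffAt_id)).differentiableAt (by simp)
  have h3 := modelDeriv_comp (localMul_unitCoord hx) h1 h2.mdifferentiableAt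
  rw [h3, modelDeriv_eq_fderiv]
  rfl

end UnitChart

/-! ### Central vectors are bi-invariant -/

section Center

open Filter Topology

variable {E : Type*} [NormedAddCommGroup E] [NormedSpace ℝ E]
  {G : Type*} [TopologicalSpace G] [ChartedSpace E G] [Group G]

variable (E) in
/-- The adjoint representation of `G`. -/
noncomputable def adjointAction (g : G) : E →L[ℝ] E := modelDeriv E E (fun y => g * y * g⁻¹) (1 : G)

theorem adjointAction_one : adjointAction E (1 : G) = ContinuousLinearMap.id ℝ E := by
  simp only [adjointAction, one_mul, inv_one, mul_one]
  exact mfderiv_id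

variable [LieGroup 𝓘(ℝ, E) ∞ G]

theorem inverse_modelDeriv_unitChartSymm {x : E} (hx : x ∈ unitTarget E G) :
    (modelDeriv E E (unitChartSymm G) x).inverse =
      modelDeriv E E (unitChart E) (unitChartSymm G x) := by
  have hS := (contMDiffAt_unitChartSymm hx).mdifferentiableAt (by simp)
  have hC := (contMDiffAt_unitChart hx).mdifferentiableAt (by simp)
  apply ContinuousLinearMap.inverse_eq
  · have e : (fun g => unitChartSymm G (unitChart E g)) =ᶠ[𝓝 (unitChartSymm G x)] id :=
      eventually_unitChartSymm_unitChart hx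
    rw [← modelDeriv_comp (unitChart_unitChartSymm hx) hS hC, e.modelDeriv_eq]
    exact mfderiv_id
  · have e : (fun z => unitChart E (unitChartSymm G z)) =ᶠ[𝓝 x] id := by
      filter_upwards [isOpen_unitTarget.mem_nhds hx] with y hy using unitChart_unitChartSymm hy
    rw [← modelDeriv_comp rfl hC hS, e.modelDeriv_eq, modelDeriv_eq_fderiv, fderiv_id]

theorem inverse_modelDeriv_leftField {x : E} (hx : x ∈ unitTarget E G) (V : E) :
    (modelDeriv E E (unitChartSymm G) x).inverse (leftField V (unitChartSymm G x)) =
      localFrame G x V := by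
  have h := modelDeriv_localFrame (h := fun g : G => g) (g := 1) hx
    (by exact mdifferentiableAt_id) V
  simp only [one_mul] at h
  have h2 : modelDeriv E E (fun g : G => g) (unitChartSymm G x) = ContinuousLinearMap.id ℝ E :=
    mfderiv_id
  rw [h2, ContinuousLinearMap.id_apply] at h
  rw [← h, inverse_modelDeriv_unitChartSymm hx]
  have e : (fun z => unitChart E (unitChartSymm G z)) =ᶠ[𝓝 x] id := by
    filter_upwards [isOpen_unitTarget.mem_nhds hx] with y hy using unitChart_unitChartSymm hy
  have h3 := modelDeriv_comp rfl ((contMDiffAt_unitChart hx).mdifferentiableAt (by simp))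
    ((contMDiffAt_unitChartSymm hx).mdifferentiableAt (by simp))
  rw [e.modelDeriv_eq, modelDeriv_eq_fderiv, fderiv_id] at h3
  exact (congrArg (fun L => L (localFrame G x V)) h3).symm

variable (G) in
/-- The bracket of the Lie algebra of `G`, with vectors regarded as elements of the model space. -/
noncomputable def leftBracket (V W : E) : E :=
  (⁅(show GroupLieAlgebra 𝓘(ℝ, E) G from V), (show GroupLieAlgebra 𝓘(ℝ, E) G from W)⁆ :
    GroupLieAlgebra 𝓘(ℝ, E) G)

/-- The Lie bracket of `𝔤` in terms of the left-invariant frame in the chart at the identity. -/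
theorem leftBracket_eq_localFrame (V W : E) :
    leftBracket G V W = fderiv ℝ (fun x => localFrame G x W) (unitCoord E G) V -
      fderiv ℝ (fun x => localFrame G x V) (unitCoord E G) W := by
  have hpull : ∀ U : E, VectorField.mpullbackWithin 𝓘(ℝ, E) 𝓘(ℝ, E)
      (extChartAt 𝓘(ℝ, E) (1 : G)).symm (mulInvariantVectorField (I := 𝓘(ℝ, E)) (G := G) U)
      (Set.range 𝓘(ℝ, E)) =ᶠ[𝓝 (unitCoord E G)] fun x => localFrame G x U := by
    intro U
    filter_upwards [unitTarget_mem_nhds] with x hx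
    rw [← inverse_modelDeriv_leftField hx, VectorField.mpullbackWithin_apply,
      modelWithCornersSelf_coe, Set.range_id, mfderivWithin_univ]
    rfl
  have hset : (extChartAt 𝓘(ℝ, E) (1 : G)).symm ⁻¹' Set.univ ∩ Set.range 𝓘(ℝ, E) = Set.univ := by
    simp
  set p : E → E → E := fun U => VectorField.mpullbackWithin 𝓘(ℝ, E) 𝓘(ℝ, E)
    (extChartAt 𝓘(ℝ, E) (1 : G)).symm (mulInvariantVectorField (I := 𝓘(ℝ, E)) (G := G) U)
    (Set.range 𝓘(ℝ, E)) with hp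
  have h1 : leftBracket G V W = (modelDeriv E E (unitChart E) (1 : G)).inverse
      (VectorField.lieBracketWithin ℝ (p V) (p W)
        ((extChartAt 𝓘(ℝ, E) (1 : G)).symm ⁻¹' Set.univ ∩ Set.range 𝓘(ℝ, E))
        (unitCoord E G)) := rfl
  rw [h1, hset, VectorField.lieBracketWithin_univ, modelDeriv_unitChart_one,
    ContinuousLinearMap.inverse_id, ContinuousLinearMap.id_apply]
  have h : VectorField.lieBracket ℝ (p V) (p W) (unitCoord E G) = _ :=
    (hpull V).lieBracket_vectorField_eq (𝕜 := ℝ) (hpull W)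
  rw [h]
  simp only [VectorField.lieBracket, localFrame_unitCoord, ContinuousLinearMap.id_apply]

theorem mdifferentiableAt_conj (g h : G) :
    MDifferentiableAt 𝓘(ℝ, E) 𝓘(ℝ, E) (fun y => g * y * g⁻¹) h :=
  (mdiffAt_mul_right (E := E) g⁻¹ (g * h)).comp h (mdiffAt_mul_left (E := E) g h)

theorem adjointAction_mul (g h : G) :
    adjointAction E (g * h) = (adjointAction E g).comp (adjointAction E h) := by
  rw [adjointAction, adjointAction, adjointAction, ← modelDeriv_comp (by simp)
    (mdifferentiableAt_conj g 1) (mdifferentiableAt_conj h 1)]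
  simp only [mul_inv_rev, mul_assoc]

theorem isBiInvariant_of_adjointAction {V : E} (h : ∀ g : G, adjointAction E g V = V) :
    IsBiInvariant G V := by
  intro g
  have h1 := modelDeriv_comp (f := fun y : G => g * y * g⁻¹) (x := 1) (y := 1) (by simp)
    (mdiffAt_mul_right (E := E) g 1) (mdifferentiableAt_conj g 1)
  simp only [inv_mul_cancel_right] at h1
  conv_lhs => rw [← h g]
  rw [leftField, h1]
  rfl

variable (G) in
/-- Conjugation `(x, y) ↦ x y x⁻¹` in the preferred chart at the identity. -/
noncomputable def localConj (x y : E) : E :=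
  unitChart E (unitChartSymm G x * unitChartSymm G y * (unitChartSymm G x)⁻¹)

theorem contDiffAt_localConj {x : E} (hx : x ∈ unitTarget E G) :
    ContDiffAt ℝ ∞ (Function.uncurry (localConj G)) (x, unitCoord E G) := by
  rw [← contMDiffAt_iff_contDiffAt]
  have h1 : ContMDiffAt 𝓘(ℝ, E × E) 𝓘(ℝ, E) ∞ (fun p : E × E => (unitChartSymm G p.1)⁻¹)
      (x, unitCoord E G) :=
    ((contMDiffAt_unitChartSymm hx).comp (x, unitCoord E G)
      contDiff_fst.contMDiff.contMDiffAt).inv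
  refine ContMDiffAt.comp (x, unitCoord E G) (g := unitChart E)
    (f := fun p : E × E => unitChartSymm G p.1 * unitChartSymm G p.2 * (unitChartSymm G p.1)⁻¹) ?_
    ((contMDiffAt_mul_unitChartSymm hx unitCoord_mem).mul h1)
  simpa using contMDiffAt_unitChart_one (E := E) (G := G)

theorem fderiv_localConj (x : E) :
    fderiv ℝ (localConj G x) (unitCoord E G) = adjointAction E (unitChartSymm G x) := by
  have h1 := modelDeriv_comp (f := unitChartSymm G) (x := unitCoord E G) unitChartSymm_unitCoord
    (mdifferentiableAt_conj (E := E) (unitChartSymm G x) 1)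
    ((contMDiffAt_unitChartSymm unitCoord_mem).mdifferentiableAt (by simp))
  have h2 := modelDeriv_comp (g := unitChart E)
    (f := fun v : E => unitChartSymm G x * unitChartSymm G v * (unitChartSymm G x)⁻¹)
    (x := unitCoord E G) (y := (1 : G)) (by simp)
    (contMDiffAt_unitChart_one.mdifferentiableAt (by simp))
    ((mdifferentiableAt_conj (E := E) (unitChartSymm G x) _).comp _
      ((contMDiffAt_unitChartSymm unitCoord_mem).mdifferentiableAt (by simp)))
  rw [← modelDeriv_eq_fderiv]
  refine h2.trans ?_
  rw [h1, modelDeriv_unitChart_one, modelDeriv_unitChartSymm_unitCoord]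
  rfl

/-- The derivative of the adjoint representation at the identity is the bracket. This follows by
differentiating `x y = (x y x⁻¹) x` in `y` and then in `x`, as the second derivative of the group
law is symmetric. -/
theorem hasFDerivAt_adjointAction (V W : E) :
    HasFDerivAt (fun x => adjointAction E (unitChartSymm G x) V)
      (fderiv ℝ (fun x => adjointAction E (unitChartSymm G x) V) (unitCoord E G)) (unitCoord E G) ∧
    fderiv ℝ (fun x => adjointAction E (unitChartSymm G x) V) (unitCoord E G) W =
      leftBracket G W V := by
  set c := unitCoord E G with hc
  set k : E → E := fun x => adjointAction E (unitChartSymm G x) V with hk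
  -- the right-invariant frame: `C x` is the derivative at the identity of right translation by `x`
  set C : E → E →L[ℝ] E := fun x => fderiv ℝ (fun y => localMul G y x) c with hC
  set M : E × E → E := Function.uncurry (localMul G) with hM
  have hcT : c ∈ unitTarget E G := unitCoord_mem
  have hMc : ContDiffAt ℝ ∞ M (c, c) := contDiffAt_localMul_left hcT
  have hkd : DifferentiableAt ℝ k c := by
    have h1 : ContDiffAt ℝ ∞ (fun x => fderiv ℝ (localConj G x) c) c :=
      (contDiffAt_localConj hcT).fderiv (g := fun _ => c) contDiffAt_const (by simp)
    have h2 : DifferentiableAt ℝ (fun x => fderiv ℝ (localConj G x) c V) c :=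
      (h1.differentiableAt (by simp)).clm_apply (differentiableAt_const V)
    refine h2.congr_of_eventuallyEq ?_
    filter_upwards [unitTarget_mem_nhds] with x hx
    rw [fderiv_localConj x]
  refine ⟨hkd.hasFDerivAt, ?_⟩
  have hCd : DifferentiableAt ℝ C c := by
    have h0 : ContDiffAt ℝ ∞ (Function.uncurry fun x y => localMul G y x) (c, c) :=
      ContDiffAt.comp (c, c) (g := M) (f := fun p : E × E => (p.2, p.1)) hMc
        (contDiffAt_snd.prodMk contDiffAt_fst)
    exact (h0.fderiv (m := ∞) (g := fun _ => c) contDiffAt_const (by simp)).differentiableAt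
      (by simp)
  have hAd : DifferentiableAt ℝ (localFrame G) c :=
    (contDiffAt_localFrame hcT).differentiableAt (by simp)
  have hkc : k c = V := by
    simp [hk, hc, adjointAction_one]
  have hCc : C c = ContinuousLinearMap.id ℝ E := by
    have e : (fun y => localMul G y c) =ᶠ[𝓝 c] id := by
      filter_upwards [unitTarget_mem_nhds] with x hx using localMul_unitCoord hx
    rw [hC]
    exact e.fderiv_eq.trans fderiv_id
  -- `x y = (x y x⁻¹) x`, differentiated in `y` at the identity
  have hrel : ∀ᶠ x in 𝓝 c, localFrame G x V = C x (k x) := by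
    filter_upwards [unitTarget_mem_nhds] with x hx
    have hκ : ContDiffAt ℝ ∞ (localConj G x) c :=
      (contDiffAt_localConj hx).comp c (contDiffAt_const.prodMk contDiffAt_id)
    have hκc : localConj G x c = c := by
      rw [localConj, hc, unitChartSymm_unitCoord, mul_one, mul_inv_cancel]
      rfl
    have e : localMul G x =ᶠ[𝓝 c] fun y => localMul G (localConj G x y) x := by
      have hlim : Tendsto (fun y => unitChartSymm G x * unitChartSymm G y * (unitChartSymm G x)⁻¹)
          (𝓝 c) (𝓝 (unitChartSymm G c)) := by
        have : ContinuousMul G := continuousMul_of_contMDiffMul 𝓘(ℝ, E) ∞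
        have h1 := ((continuousAt_unitChartSymm hcT).tendsto.const_mul
          (unitChartSymm G x)).mul_const (unitChartSymm G x)⁻¹
        simpa [hc] using h1
      filter_upwards [hlim.eventually (eventually_unitChartSymm_unitChart hcT)] with y hy
      rw [localMul, localMul, localConj, hy, inv_mul_cancel_right]
    have hM' : DifferentiableAt ℝ (fun y => localMul G y x) (localConj G x c) := by
      rw [hκc]
      exact ((contDiffAt_localMul_right hx).comp c
        (contDiffAt_id.prodMk contDiffAt_const)).differentiableAt (by simp)
    have h2 : fderiv ℝ (fun y => localMul G (localConj G x y) x) c =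
        (fderiv ℝ (fun y => localMul G y x) (localConj G x c)).comp
          (fderiv ℝ (localConj G x) c) :=
      fderiv_comp c hM' (hκ.differentiableAt (by simp))
    rw [localFrame, ← hc, e.fderiv_eq, h2, hκc, hc, fderiv_localConj]
    rfl
  have hL : HasFDerivAt (fun x => localFrame G x V) ((fderiv ℝ (localFrame G) c).flip V) c := by
    simpa using hAd.hasFDerivAt.clm_apply (hasFDerivAt_const V c)
  have hR := hCd.hasFDerivAt.clm_apply hkd.hasFDerivAt
  have h3 := congrArg (fun L => L W) (hL.unique (hR.congr_of_eventuallyEq hrel))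
  simp only [ContinuousLinearMap.flip_apply, _root_.add_apply,
    ContinuousLinearMap.comp_apply, hCc, hkc, ContinuousLinearMap.id_apply] at h3
  -- symmetry of the second derivative of the group law
  have hD : DifferentiableAt ℝ (fderiv ℝ M) (c, c) :=
    (hMc.fderiv_right (m := ∞) (by simp)).differentiableAt (by simp)
  have hMev : ∀ᶠ p in 𝓝 (c, c), DifferentiableAt ℝ M p := by
    filter_upwards [(hMc.of_le (m := 1) (by simp)).eventually (by simp)] with p hp
    exact hp.differentiableAt (by simp)
  have hA' : HasFDerivAt (localFrame G) (((ContinuousLinearMap.compL ℝ E (E × E) E).flip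
      (ContinuousLinearMap.inr ℝ E E)).comp ((fderiv ℝ (fderiv ℝ M) (c, c)).comp
        (ContinuousLinearMap.inl ℝ E E))) c := by
    have h4 : HasFDerivAt (fun x : E => (x, c)) (ContinuousLinearMap.inl ℝ E E) c :=
      hasFDerivAt_prodMk_left c c
    have h5 := (((ContinuousLinearMap.compL ℝ E (E × E) E).flip
      (ContinuousLinearMap.inr ℝ E E)).hasFDerivAt).comp c
        (HasFDerivAt.comp (f := fun x : E => (x, c)) c hD.hasFDerivAt h4)
    refine h5.congr_of_eventuallyEq ?_
    filter_upwards [h4.continuousAt.eventually hMev] with x hx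
    exact (hx.hasFDerivAt.comp c (hasFDerivAt_prodMk_right x c)).fderiv
  have hC' : HasFDerivAt C (((ContinuousLinearMap.compL ℝ E (E × E) E).flip
      (ContinuousLinearMap.inl ℝ E E)).comp ((fderiv ℝ (fderiv ℝ M) (c, c)).comp
        (ContinuousLinearMap.inr ℝ E E))) c := by
    have h4 : HasFDerivAt (fun x : E => (c, x)) (ContinuousLinearMap.inr ℝ E E) c :=
      hasFDerivAt_prodMk_right c c
    have h5 := (((ContinuousLinearMap.compL ℝ E (E × E) E).flip
      (ContinuousLinearMap.inl ℝ E E)).hasFDerivAt).comp c (hD.hasFDerivAt.comp c h4)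
    refine h5.congr_of_eventuallyEq ?_
    filter_upwards [h4.continuousAt.eventually hMev] with x hx
    exact (HasFDerivAt.comp (f := fun y : E => (y, x)) c hx.hasFDerivAt
      (hasFDerivAt_prodMk_left c x)).fderiv
  have hsymm : fderiv ℝ C c W V = fderiv ℝ (localFrame G) c V W := by
    rw [hA'.fderiv, hC'.fderiv]
    exact (hMc.isSymmSndFDerivAt (by
      rw [minSmoothness_of_isRCLikeNormedField]
      exact ENat.LEInfty.out)).eq _ _
  have hL' : HasFDerivAt (fun x => localFrame G x W) ((fderiv ℝ (localFrame G) c).flip W) c := by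
    simpa using hAd.hasFDerivAt.clm_apply (hasFDerivAt_const W c)
  rw [leftBracket_eq_localFrame, ← hc, hL.fderiv, hL'.fderiv]
  simp only [ContinuousLinearMap.flip_apply]
  rw [h3, hsymm, add_sub_cancel_right]

/-- On a connected group, a vector that commutes with the whole Lie algebra is bi-invariant: its
stabilizer under the adjoint representation is an open subgroup. -/
theorem isBiInvariant_of_leftBracket_eq_zero [ConnectedSpace G] {V : E}
    (hV : ∀ W, leftBracket G W V = 0) : IsBiInvariant G V := by
  have : IsTopologicalGroup G := topologicalGroup_of_lieGroup 𝓘(ℝ, E) ∞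
  set c := unitCoord E G with hc
  have hcT : c ∈ unitTarget E G := unitCoord_mem
  set k : E → E := fun x => adjointAction E (unitChartSymm G x) V with hk
  have hk0 : HasFDerivAt k (0 : E →L[ℝ] E) c := by
    have h := (hasFDerivAt_adjointAction (G := G) V 0).1
    have h0 : fderiv ℝ (fun x => adjointAction E (unitChartSymm G x) V) (unitCoord E G) = 0 := by
      ext W
      rw [(hasFDerivAt_adjointAction (G := G) V W).2, hV]
      rfl
    rwa [h0] at h
  have hkx : ∀ x ∈ unitTarget E G, HasFDerivAt k (0 : E →L[ℝ] E) x := by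
    intro x hx
    -- the chart of the translate `(unitChartSymm x)⁻¹ * ·`
    set s : E → E := fun y => unitChart E ((unitChartSymm G x)⁻¹ * unitChartSymm G y) with hs
    have hsx : s x = c := by simp [hs, hc, unitCoord]
    have hsd : DifferentiableAt ℝ s x := by
      rw [← mdifferentiableAt_iff_differentiableAt]
      refine MDifferentiableAt.comp x (g := unitChart E)
        (f := fun y => (unitChartSymm G x)⁻¹ * unitChartSymm G y) (I' := 𝓘(ℝ, E)) ?_
        ((mdiffAt_mul_left (E := E) _ _).comp x
          ((contMDiffAt_unitChartSymm hx).mdifferentiableAt (by simp)))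
      rw [inv_mul_cancel]
      exact contMDiffAt_unitChart_one.mdifferentiableAt (by simp)
    have hlim : Tendsto (fun y => (unitChartSymm G x)⁻¹ * unitChartSymm G y)
        (𝓝 x) (𝓝 (unitChartSymm G c)) := by
      have h1 := (continuousAt_unitChartSymm hx).tendsto.const_mul (unitChartSymm G x)⁻¹
      simpa [hc] using h1
    have e : k =ᶠ[𝓝 x] fun y => adjointAction E (unitChartSymm G x) (k (s y)) := by
      filter_upwards [hlim.eventually (eventually_unitChartSymm_unitChart hcT)] with y hy
      simp only [hk, hs]
      rw [hy, ← ContinuousLinearMap.comp_apply, ← adjointAction_mul, mul_inv_cancel_left]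
    have hk1 : HasFDerivAt k (0 : E →L[ℝ] E) (s x) := by rwa [hsx]
    have h2 := (adjointAction E (unitChartSymm G x)).hasFDerivAt.comp x
      (hk1.comp x hsd.hasFDerivAt)
    simp only [ContinuousLinearMap.zero_comp, ContinuousLinearMap.comp_zero] at h2
    exact h2.congr_of_eventuallyEq e
  obtain ⟨ε, hε, hball⟩ := Metric.isOpen_iff.1 isOpen_unitTarget c hcT
  have hconst : ∀ x ∈ Metric.ball c ε, k x = V := by
    intro x hx
    have h := (convex_ball c ε).is_const_of_fderivWithin_eq_zero (𝕜 := ℝ) (f := k)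
      (fun y hy => (hkx y (hball hy)).differentiableAt.differentiableWithinAt)
      (fun y hy => by
        rw [fderivWithin_of_isOpen Metric.isOpen_ball hy, (hkx y (hball hy)).fderiv])
      hx (Metric.mem_ball_self hε)
    rw [h]
    simp [hk, hc, adjointAction_one]
  let S : Subgroup G :=
    { carrier := {g | adjointAction E g V = V}
      one_mem' := by simp [adjointAction_one]
      mul_mem' := fun {a b} ha hb => by
        simp only [Set.mem_ofPred_eq] at ha hb ⊢
        rw [adjointAction_mul, ContinuousLinearMap.comp_apply, hb, ha]
      inv_mem' := fun {a} ha => by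
        simp only [Set.mem_ofPred_eq] at ha ⊢
        conv_lhs => rw [← ha]
        rw [← ContinuousLinearMap.comp_apply, ← adjointAction_mul, inv_mul_cancel,
          adjointAction_one, ContinuousLinearMap.id_apply] }
  have hS : IsOpen (S : Set G) := by
    refine S.isOpen_of_mem_nhds (g := 1) ?_
    have h1 : ContinuousAt (unitChart E) (1 : G) := contMDiffAt_unitChart_one.continuousAt
    have h2 := eventually_unitChartSymm_unitChart (E := E) (G := G) hcT
    rw [hc, unitChartSymm_unitCoord] at h2
    filter_upwards [h1.preimage_mem_nhds (Metric.ball_mem_nhds _ hε), h2] with g hg hg2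
    have h3 := hconst _ hg
    simp only [hk, hg2] at h3
    exact h3
  have hSt : (S : Set G) = Set.univ :=
    IsClopen.eq_univ ⟨S.isClosed_of_isOpen hS, hS⟩ ⟨1, S.one_mem⟩
  refine isBiInvariant_of_adjointAction fun g => ?_
  have : g ∈ (S : Set G) := hSt ▸ Set.mem_univ g
  exact this

end Center

/-! ### The exponential map on bi-invariant vectors -/

section Exponential

open Filter Topology

variable {E : Type*} [NormedAddCommGroup E] [NormedSpace ℝ E]
  {G : Type*} [TopologicalSpace G] [ChartedSpace E G] [Group G]

theorem IsLeftCurve.continuous {V : E} {γ : ℝ → G} (hγ : IsLeftCurve V γ) : Continuous γ :=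
  continuous_iff_continuousAt.2 fun t => (hγ t).continuousAt

/-- The domain of the preferred chart at the identity, as the image of its inverse. -/
theorem image_unitTarget_mem_nhds : unitChartSymm G '' unitTarget E G ∈ 𝓝 (1 : G) := by
  have h : unitChartSymm G '' unitTarget E G = (extChartAt 𝓘(ℝ, E) (1 : G)).source :=
    PartialEquiv.symm_image_target_eq_source _
  rw [h]
  exact extChartAt_source_mem_nhds (1 : G)

variable [LieGroup 𝓘(ℝ, E) ∞ G]

variable (G) in
/-- The bi-invariant vectors form a subspace. -/
def biInvariantSubmodule : Submodule ℝ E where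
  carrier := {V | IsBiInvariant G V}
  zero_mem' g := by simp [leftField]
  add_mem' {V W} hV hW g := by
    simpa [leftField] using congrArg₂ (· + ·) (hV g) (hW g)
  smul_mem' a V hV g := by
    simpa [leftField] using congrArg (a • ·) (hV g)

/-- The velocity of the flow of a left-invariant field, in the chart at the identity. -/
theorem IsLeftCurve.hasDerivAt_unitChart {V : E} {γ : ℝ → G} (hγ : IsLeftCurve V γ) {t : ℝ}
    (ht : γ t ∈ unitChartSymm G '' unitTarget E G) :
    HasDerivAt (fun s => unitChart E (γ s)) (localFrame G (unitChart E (γ t)) V) t := by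
  obtain ⟨x, hx, hxt⟩ := ht
  have hC := (contMDiffAt_unitChart hx).mdifferentiableAt (by simp)
  have h1 : HasMFDerivAt 𝓘(ℝ, ℝ) 𝓘(ℝ, E) (fun s => unitChart E (γ s)) t
      ((modelDeriv E E (unitChart E) (γ t)).comp
        ((1 : ℝ →L[ℝ] ℝ).smulRight (leftField V (γ t)) : ℝ →L[ℝ] E)) :=
    HasMFDerivAt.comp t (hasMFDerivAt_modelDeriv (by rwa [← hxt])) (hγ t)
  have h2 : HasFDerivAt (fun s => unitChart E (γ s)) ((modelDeriv E E (unitChart E) (γ t)).comp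
      ((1 : ℝ →L[ℝ] ℝ).smulRight (leftField V (γ t)))) t := hasMFDerivAt_iff_hasFDerivAt.1 h1
  have h3 := modelDeriv_localFrame (g := 1) (h := unitChart E) hx (by rwa [one_mul]) V
  have e : (fun z => unitChart E (1 * unitChartSymm G z)) =ᶠ[𝓝 x] id := by
    filter_upwards [isOpen_unitTarget.mem_nhds hx] with y hy
    rw [one_mul]
    exact unitChart_unitChartSymm hy
  rw [e.modelDeriv_eq, modelDeriv_eq_fderiv, fderiv_id, one_mul, hxt] at h3
  rw [← hxt, unitChart_unitChartSymm hx]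
  refine h2.hasDerivAt.congr_deriv ?_
  simpa using h3.symm

theorem IsLeftCurve.contMDiffAt_zero {V : E} {γ : ℝ → G} (hγ : IsLeftCurve V γ) (h0 : γ 0 = 1) :
    ContMDiffAt 𝓘(ℝ, ℝ) 𝓘(ℝ, E) 1 γ 0 := by
  have hcont : ContinuousAt γ 0 := hγ.continuous.continuousAt
  have hev : ∀ᶠ t in 𝓝 (0 : ℝ), γ t ∈ unitChartSymm G '' unitTarget E G :=
    hcont.eventually (h0 ▸ image_unitTarget_mem_nhds)
  have h1 : ContDiffAt ℝ 1 (fun t => unitChart E (γ t)) 0 := by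
    rw [contDiffAt_one_iff]
    refine ⟨fun t => ContinuousLinearMap.toSpanSingleton ℝ (localFrame G (unitChart E (γ t)) V),
      _, hev, ?_, fun t ht => (hγ.hasDerivAt_unitChart ht).hasFDerivAt⟩
    intro t ht
    have h2 : ContinuousAt (fun t => unitChart E (γ t)) t :=
      (hγ.hasDerivAt_unitChart ht).continuousAt
    obtain ⟨x, hx, hxt⟩ := ht
    have h3 : ContinuousAt (localFrame G) (unitChart E (γ t)) := by
      rw [← hxt, unitChart_unitChartSymm hx]
      exact (contDiffAt_localFrame hx).continuousAt
    have h4 : ContinuousAt (fun t => localFrame G (unitChart E (γ t)) V) t :=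
      (h3.comp (f := fun t => unitChart E (γ t)) h2).clm_apply continuousAt_const
    exact (((ContinuousLinearMap.toSpanSingletonCLE (𝕜 := ℝ) (E := E)).continuous.continuousAt).comp
      h4).continuousWithinAt
  have e : γ =ᶠ[𝓝 0] fun t => unitChartSymm G (unitChart E (γ t)) := by
    filter_upwards [hev] with t ht
    obtain ⟨x, hx, hxt⟩ := ht
    rw [← hxt, unitChart_unitChartSymm hx]
  refine ContMDiffAt.congr_of_eventuallyEq ?_ e
  refine ContMDiffAt.comp (0 : ℝ) (g := unitChartSymm G) (I' := 𝓘(ℝ, E)) ?_ h1.contMDiffAt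
  rw [h0]
  exact (contMDiffAt_unitChartSymm unitCoord_mem).of_le (by simp)

/-- A map `e : 𝔤 → G` is an exponential map if `t ↦ e (t V)` is the flow of `V` through `1`. -/
structure IsExponential (e : E → G) : Prop where
  zero : e 0 = 1
  curve : ∀ V, IsLeftCurve V fun t => e (t • V)

namespace IsExponential

variable {e : E → G} (he : IsExponential e)
include he

variable [T2Space G]

theorem mul_comm {V : E} (hV : IsBiInvariant G V) (g : G) : e V * g = g * e V := by
  simpa using hV.curve_mul_comm (by simp [he.zero]) (he.curve V) g 1

theorem add {V W : E} (hV : IsBiInvariant G V) : e (V + W) = e V * e W := by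
  have h := (hV.isLeftCurve_mul (he.curve W) (he.curve V)).eq (he.curve (V + W))
    (by simp [he.zero])
  simpa using (congrFun h 1).symm

/-- Flows of bi-invariant vectors are one-parameter groups, so smoothness at time `0` suffices. -/
theorem contMDiff_curve {V : E} (hV : IsBiInvariant G V) :
    ContMDiff 𝓘(ℝ, ℝ) 𝓘(ℝ, E) 1 fun t : ℝ => e (t • V) := by
  intro t
  have h0 := (he.curve V).contMDiffAt_zero (by simp [he.zero])
  have h1 : (fun s : ℝ => e (s • V)) = fun s => e (t • V) * e ((s - t) • V) := by
    funext s
    rw [← he.add ((biInvariantSubmodule G).smul_mem t hV), ← add_smul, add_sub_cancel]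
  rw [h1]
  refine (contMDiff_mul_left (n := ∞) (a := e (t • V))).contMDiffAt.of_le (by simp) |>.comp t ?_
  refine ContMDiffAt.comp t (g := fun s : ℝ => e (s • V)) (f := fun s : ℝ => s - t)
    (I' := 𝓘(ℝ, ℝ)) ?_ ?_
  · rwa [sub_self]
  · exact (contDiff_id.sub contDiff_const).contMDiff.contMDiffAt

theorem contMDiff_sum {ι : Type*} [Fintype ι] {v : ι → E} (hv : ∀ i, IsBiInvariant G (v i)) :
    ContMDiff 𝓘(ℝ, ι → ℝ) 𝓘(ℝ, E) 1 fun t : ι → ℝ => e (∑ i, t i • v i) := by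
  classical
  have : LieGroup 𝓘(ℝ, E) 1 G := LieGroup.of_le (n := ∞) (by simp)
  suffices h : ∀ s : Finset ι, ContMDiff 𝓘(ℝ, ι → ℝ) 𝓘(ℝ, E) 1
      fun t : ι → ℝ => e (∑ i ∈ s, t i • v i) from h Finset.univ
  intro s
  induction s using Finset.induction_on with
  | empty => simpa [he.zero] using contMDiff_const
  | insert i s hi ih =>
    have h1 : (fun t : ι → ℝ => e (∑ j ∈ insert i s, t j • v j)) =
        fun t => e (t i • v i) * e (∑ j ∈ s, t j • v j) := by
      funext t
      rw [Finset.sum_insert hi, he.add ((biInvariantSubmodule G).smul_mem _ (hv i))]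
    rw [h1]
    exact ((he.contMDiff_curve (hv i)).comp (contDiff_apply ℝ ℝ i).contMDiff).mul ih

/-- On a space of bi-invariant vectors the exponential map has the inclusion as its derivative at
`0`. -/
theorem hasStrictFDerivAt_sum {ι : Type*} [Fintype ι] {v : ι → E}
    (hv : ∀ i, IsBiInvariant G (v i)) :
    HasStrictFDerivAt (fun t : ι → ℝ => unitChart E (e (∑ i, t i • v i)))
      (∑ i, (ContinuousLinearMap.proj (R := ℝ) (φ := fun _ : ι => ℝ) i).smulRight (v i)) 0 := by
  have h1 : ContDiffAt ℝ 1 (fun t : ι → ℝ => unitChart E (e (∑ i, t i • v i))) 0 := by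
    rw [← contMDiffAt_iff_contDiffAt]
    refine ContMDiffAt.comp (0 : ι → ℝ) (g := unitChart E) (I' := 𝓘(ℝ, E)) ?_
      (he.contMDiff_sum hv).contMDiffAt
    simpa [he.zero] using contMDiffAt_unitChart_one.of_le (by simp)
  have h2 := h1.hasStrictFDerivAt (by simp)
  suffices h : ∑ i, (ContinuousLinearMap.proj (R := ℝ) (φ := fun _ : ι => ℝ) i).smulRight (v i) =
      fderiv ℝ (fun t : ι → ℝ => unitChart E (e (∑ i, t i • v i))) 0 by
    rw [h]
    exact h2
  refine ContinuousLinearMap.ext fun w => ?_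
  have h3 : HasDerivAt (fun s : ℝ => s • w) w 0 := by
    simpa using (hasDerivAt_id (0 : ℝ)).smul_const w
  have h4 := HasFDerivAt.comp_hasDerivAt (x := (0 : ℝ)) (f := fun s : ℝ => s • w)
    (l := fun t : ι → ℝ => unitChart E (e (∑ i, t i • v i)))
    (by simpa using h2.hasFDerivAt) h3
  have h5 := (he.curve (∑ i, w i • v i)).hasDerivAt_unitChart (t := 0) (by
    simpa [he.zero] using mem_of_mem_nhds image_unitTarget_mem_nhds)
  have h6 : (fun s : ℝ => unitChart E (e (s • ∑ i, w i • v i))) =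
      (fun t : ι → ℝ => unitChart E (e (∑ i, t i • v i))) ∘ fun s : ℝ => s • w := by
    funext s
    simp [Finset.smul_sum, smul_smul]
  rw [h6] at h5
  have h7 := h5.unique h4
  have h8 : localFrame G (unitChart E (1 : G)) = ContinuousLinearMap.id ℝ E := localFrame_unitCoord
  simp only [zero_smul, he.zero, h8, ContinuousLinearMap.id_apply] at h7
  rw [← h7]
  simp

/-- The exponential map is injective near `0` on a space of bi-invariant vectors. -/
theorem eventually_ne_one {ι : Type*} [Fintype ι] {v : ι → E} (hv : ∀ i, IsBiInvariant G (v i))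
    (hli : LinearIndependent ℝ v) : ∀ᶠ t in 𝓝[≠] (0 : ι → ℝ), e (∑ i, t i • v i) ≠ 1 := by
  set L := ∑ i, (ContinuousLinearMap.proj (R := ℝ) (φ := fun _ : ι => ℝ) i).smulRight (v i) with hL
  have hker : LinearMap.ker (L : (ι → ℝ) →ₗ[ℝ] E) = ⊥ := by
    rw [LinearMap.ker_eq_bot']
    intro t ht
    funext i
    exact Fintype.linearIndependent_iff.1 hli t (by simpa [hL] using ht) i
  obtain ⟨C, -, hC⟩ := (L : (ι → ℝ) →ₗ[ℝ] E).exists_antilipschitzWith hker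
  have h := (he.hasStrictFDerivAt_sum hv).hasFDerivAt.eventually_ne (c := unitChart E (1 : G))
    ⟨C, hC⟩
  filter_upwards [h] with t ht h1
  exact ht (by rw [h1])

/-- On a connected group all of whose vectors are bi-invariant, the exponential map is onto. -/
theorem surjective_sum [CompleteSpace E] [ConnectedSpace G] {ι : Type*} [Fintype ι] {v : ι → E}
    (hv : ∀ i, IsBiInvariant G (v i)) (hspan : Submodule.span ℝ (Set.range v) = ⊤) :
    Function.Surjective fun t : ι → ℝ => e (∑ i, t i • v i) := by
  have : IsTopologicalGroup G := topologicalGroup_of_lieGroup 𝓘(ℝ, E) ∞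
  have hcont : Continuous fun t : ι → ℝ => e (∑ i, t i • v i) := (he.contMDiff_sum hv).continuous
  have hsurj : LinearMap.range (∑ i, (ContinuousLinearMap.proj (R := ℝ)
      (φ := fun _ : ι => ℝ) i).smulRight (v i) : (ι → ℝ) →L[ℝ] E).toLinearMap = ⊤ := by
    rw [eq_top_iff, ← hspan, Submodule.span_le]
    rintro _ ⟨i, rfl⟩
    classical
    exact ⟨Pi.single i 1, by simp [Pi.single_apply]⟩
  have hmap := (he.hasStrictFDerivAt_sum hv).map_nhds_eq_of_surj hsurj
  simp only [Pi.zero_apply, zero_smul, Finset.sum_const_zero, he.zero] at hmap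
  have hb : ∀ w : ι → ℝ, IsBiInvariant G (∑ i, w i • v i) := fun w =>
    (biInvariantSubmodule G).sum_mem fun i _ => (biInvariantSubmodule G).smul_mem _ (hv i)
  let S : Subgroup G :=
    { carrier := Set.range fun t : ι → ℝ => e (∑ i, t i • v i)
      one_mem' := ⟨0, by simp [he.zero]⟩
      mul_mem' := by
        rintro _ _ ⟨s, rfl⟩ ⟨t, rfl⟩
        exact ⟨s + t, by simp [add_smul, Finset.sum_add_distrib, he.add (hb s)]⟩
      inv_mem' := by
        rintro _ ⟨s, rfl⟩
        refine ⟨-s, eq_inv_of_mul_eq_one_left ?_⟩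
        simp only
        rw [← he.add (hb (-s))]
        simp [he.zero] }
  have hS : IsOpen (S : Set G) := by
    refine S.isOpen_of_mem_nhds (g := 1) ?_
    have hU : {t : ι → ℝ | unitChartSymm G (unitChart E (e (∑ i, t i • v i))) =
        e (∑ i, t i • v i)} ∈ 𝓝 (0 : ι → ℝ) := by
      refine hcont.continuousAt.eventually
        (p := fun g => unitChartSymm G (unitChart E g) = g) ?_
      simpa [he.zero] using
        eventually_unitChartSymm_unitChart (unitCoord_mem (E := E) (G := G))
    have h1 := hmap ▸ image_mem_map hU
    have h2 := eventually_unitChartSymm_unitChart (unitCoord_mem (E := E) (G := G))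
    rw [unitChartSymm_unitCoord] at h2
    have h3 : ContinuousAt (unitChart E) (1 : G) := contMDiffAt_unitChart_one.continuousAt
    filter_upwards [h3.preimage_mem_nhds h1, h2] with g ⟨t, ht, htg⟩ hg
    refine ⟨t, ?_⟩
    rw [← hg, ← htg]
    exact ht.symm
  have hSt : (S : Set G) = Set.univ :=
    IsClopen.eq_univ ⟨S.isClosed_of_isOpen hS, hS⟩ ⟨1, S.one_mem⟩
  intro g
  have : g ∈ (S : Set G) := hSt ▸ Set.mem_univ g
  exact this

end IsExponential

end Exponential

/-! ### Left-invariant derivatives -/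

section LeftDeriv

open Filter Topology MeasureTheory

variable {E : Type*} [NormedAddCommGroup E] [NormedSpace ℝ E]
  {G : Type*} [TopologicalSpace G] [ChartedSpace E G] [Group G]

/-- The derivative of a function on `G` along the left-invariant vector field determined by `V`. -/
noncomputable def leftDeriv (V : E) (h : G → ℂ) (g : G) : ℂ := modelDeriv E ℂ h g (leftField V g)

variable [LieGroup 𝓘(ℝ, E) ∞ G]

theorem contMDiffAt_mul_unitChartSymm_const (g : G) {x : E} (hx : x ∈ unitTarget E G) :
    ContMDiffAt 𝓘(ℝ, E) 𝓘(ℝ, E) ∞ (fun v => g * unitChartSymm G v) x :=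
  (contMDiff_mul_left (a := g)).contMDiffAt.comp x (contMDiffAt_unitChartSymm hx)

/-- Smoothness at `g` can be tested in the left translate by `g` of the chart at the identity. -/
theorem contMDiffAt_iff_unitChartSymm {E' M' : Type*} [NormedAddCommGroup E'] [NormedSpace ℝ E']
    [TopologicalSpace M'] [ChartedSpace E' M'] {h : G → M'} {g : G} {n : WithTop ℕ∞} (hn : n ≤ ∞) :
    ContMDiffAt 𝓘(ℝ, E) 𝓘(ℝ, E') n h g ↔
      ContMDiffAt 𝓘(ℝ, E) 𝓘(ℝ, E') n (fun v => h (g * unitChartSymm G v)) (unitCoord E G) := by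
  constructor
  · intro hh
    refine ContMDiffAt.comp (unitCoord E G) (g := h) (I' := 𝓘(ℝ, E)) ?_
      ((contMDiffAt_mul_unitChartSymm_const g unitCoord_mem).of_le hn)
    simpa using hh
  · intro hh
    have h1 : ContMDiffAt 𝓘(ℝ, E) 𝓘(ℝ, E) n (fun y => unitChart E (g⁻¹ * y)) g := by
      refine ContMDiffAt.comp g (g := unitChart E) (I' := 𝓘(ℝ, E)) ?_
        ((contMDiff_mul_left (n := ∞) (a := g⁻¹)).contMDiffAt.of_le hn)
      rw [inv_mul_cancel]
      exact contMDiffAt_unitChart_one.of_le hn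
    have h2 : ContMDiffAt 𝓘(ℝ, E) 𝓘(ℝ, E') n
        (fun y => h (g * unitChartSymm G (unitChart E (g⁻¹ * y)))) g := by
      refine ContMDiffAt.comp g (g := fun v => h (g * unitChartSymm G v)) (I' := 𝓘(ℝ, E)) ?_ h1
      rw [inv_mul_cancel]
      exact hh
    refine h2.congr_of_eventuallyEq ?_
    have : ContinuousMul G := continuousMul_of_contMDiffMul 𝓘(ℝ, E) ∞
    have h3 : Tendsto (fun y => g⁻¹ * y) (𝓝 g) (𝓝 (unitChartSymm G (unitCoord E G))) := by
      have := (continuous_const_mul g⁻¹).tendsto g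
      simpa using this
    filter_upwards [h3.eventually (eventually_unitChartSymm_unitChart unitCoord_mem)] with y hy
    rw [hy, mul_inv_cancel_left]

theorem mdifferentiableAt_of_unitChartSymm {h : G → ℂ} {g : G}
    (hh : DifferentiableAt ℝ (fun v => h (g * unitChartSymm G v)) (unitCoord E G)) :
    MDifferentiableAt 𝓘(ℝ, E) 𝓘(ℝ, ℂ) h g := by
  have h1 : MDifferentiableAt 𝓘(ℝ, E) 𝓘(ℝ, E) (fun y => unitChart E (g⁻¹ * y)) g := by
    refine MDifferentiableAt.comp g (g := unitChart E) (I' := 𝓘(ℝ, E)) ?_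
      (mdiffAt_mul_left (E := E) g⁻¹ g)
    rw [inv_mul_cancel]
    exact contMDiffAt_unitChart_one.mdifferentiableAt (by simp)
  have h2 : MDifferentiableAt 𝓘(ℝ, E) 𝓘(ℝ, ℂ)
      (fun y => h (g * unitChartSymm G (unitChart E (g⁻¹ * y)))) g := by
    refine MDifferentiableAt.comp g (g := fun v => h (g * unitChartSymm G v)) (I' := 𝓘(ℝ, E)) ?_ h1
    rw [inv_mul_cancel]
    exact hh.mdifferentiableAt
  refine h2.congr_of_eventuallyEq ?_
  have : ContinuousMul G := continuousMul_of_contMDiffMul 𝓘(ℝ, E) ∞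
  have h3 : Tendsto (fun y => g⁻¹ * y) (𝓝 g) (𝓝 (unitChartSymm G (unitCoord E G))) := by
    have := (continuous_const_mul g⁻¹).tendsto g
    simpa using this
  filter_upwards [h3.eventually (eventually_unitChartSymm_unitChart unitCoord_mem)] with y hy
  rw [hy, mul_inv_cancel_left]

theorem leftDeriv_eq_fderiv {h : G → ℂ} {g : G}
    (hh : MDifferentiableAt 𝓘(ℝ, E) 𝓘(ℝ, ℂ) h g) (V : E) :
    leftDeriv V h g = fderiv ℝ (fun v => h (g * unitChartSymm G v)) (unitCoord E G) V := by
  rw [leftDeriv, ← modelDeriv_mul_unitChartSymm hh, modelDeriv_eq_fderiv]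

theorem fderiv_localFrame {h : G → ℂ} {g : G} {x : E} (hx : x ∈ unitTarget E G)
    (hh : MDifferentiableAt 𝓘(ℝ, E) 𝓘(ℝ, ℂ) h (g * unitChartSymm G x)) (V : E) :
    fderiv ℝ (fun v => h (g * unitChartSymm G v)) x (localFrame G x V) =
      leftDeriv V h (g * unitChartSymm G x) := by
  rw [← modelDeriv_eq_fderiv, modelDeriv_localFrame hx hh]
  rfl

theorem differentiableAt_unitChartSymm {h : G → ℂ} {g : G} {x : E} (hx : x ∈ unitTarget E G)
    (hh : MDifferentiableAt 𝓘(ℝ, E) 𝓘(ℝ, ℂ) h (g * unitChartSymm G x)) :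
    DifferentiableAt ℝ (fun v => h (g * unitChartSymm G v)) x := by
  rw [← mdifferentiableAt_iff_differentiableAt]
  exact hh.comp x ((contMDiffAt_mul_unitChartSymm_const g hx).mdifferentiableAt (by simp))

/-- Left-invariant derivatives commute with translation by a central element on the right. -/
theorem leftDeriv_comp_mul_right {h : G → ℂ} (hh : MDifferentiable 𝓘(ℝ, E) 𝓘(ℝ, ℂ) h) {a : G}
    (ha : ∀ g, a * g = g * a) (V : E) (g : G) :
    leftDeriv V (fun y => h (y * a)) g = leftDeriv V h (g * a) := by
  have h1 : MDifferentiable 𝓘(ℝ, E) 𝓘(ℝ, ℂ) fun y => h (y * a) := fun y =>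
    (hh (y * a)).comp y (mdiffAt_mul_right (E := E) a y)
  rw [leftDeriv_eq_fderiv (h1 g), leftDeriv_eq_fderiv (hh _)]
  simp only [mul_assoc, ha]

theorem leftDeriv_comp_mul_left {h : G → ℂ} (hh : MDifferentiable 𝓘(ℝ, E) 𝓘(ℝ, ℂ) h) (a : G)
    (V : E) (g : G) :
    leftDeriv V (fun y => h (a * y)) g = leftDeriv V h (a * g) := by
  have h1 : MDifferentiable 𝓘(ℝ, E) 𝓘(ℝ, ℂ) fun y => h (a * y) := fun y =>
    (hh (a * y)).comp y (mdiffAt_mul_left (E := E) a y)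
  rw [leftDeriv_eq_fderiv (h1 g), leftDeriv_eq_fderiv (hh _)]
  simp only [mul_assoc]

theorem contMDiff_leftDeriv {h : G → ℂ} (hh : ContMDiff 𝓘(ℝ, E) 𝓘(ℝ, ℂ) ∞ h) (V : E) :
    ContMDiff 𝓘(ℝ, E) 𝓘(ℝ, ℂ) ∞ (leftDeriv V h) := by
  intro g
  rw [contMDiffAt_iff_unitChartSymm le_rfl, contMDiffAt_iff_contDiffAt]
  have h1 : ContDiffAt ℝ ∞ (fun v => h (g * unitChartSymm G v)) (unitCoord E G) := by
    rw [← contMDiffAt_iff_contDiffAt]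
    exact (contMDiffAt_iff_unitChartSymm le_rfl).1 (hh g)
  have h2 := (h1.fderiv_right (m := ∞) (by simp)).clm_apply
    ((contDiffAt_localFrame unitCoord_mem).clm_apply (contDiffAt_const (c := V)))
  refine h2.congr_of_eventuallyEq ?_
  filter_upwards [unitTarget_mem_nhds] with x hx
  exact (fderiv_localFrame hx (hh.mdifferentiable (by simp) _) V).symm

variable [CompleteSpace E]

variable (G) in
/-- The left-invariant coframe in the preferred chart at the identity. -/
noncomputable def localCoframe (x : E) : E →L[ℝ] E := (localFrame G x).inverse

theorem contDiffAt_localCoframe : ContDiffAt ℝ ∞ (localCoframe G) (unitCoord E G) := by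
  refine ContDiffAt.comp (unitCoord E G) (g := ContinuousLinearMap.inverse) ?_
    (contDiffAt_localFrame unitCoord_mem)
  rw [localFrame_unitCoord]
  exact contDiffAt_map_inverse (ContinuousLinearEquiv.refl ℝ E)

theorem eventually_localFrame_localCoframe :
    ∀ᶠ x in 𝓝 (unitCoord E G), (localFrame G x).comp (localCoframe G x) =
      ContinuousLinearMap.id ℝ E := by
  have h1 : ∀ᶠ L in 𝓝 (localFrame G (unitCoord E G)), L ∈ Set.range
      ((↑) : (E ≃L[ℝ] E) → E →L[ℝ] E) := by
    rw [localFrame_unitCoord]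
    exact ContinuousLinearEquiv.nhds (ContinuousLinearEquiv.refl ℝ E)
  filter_upwards [(contDiffAt_localFrame unitCoord_mem).continuousAt.eventually h1] with x ⟨e, he⟩
  rw [localCoframe, ← he, ContinuousLinearMap.inverse_equiv,
    ContinuousLinearEquiv.coe_comp_coe_symm]

/-- The derivative of a function in a translate of the chart at the identity is determined by its
left-invariant derivatives. -/
theorem eventually_hasFDerivAt {ι : Type*} [Fintype ι] [FiniteDimensional ℝ E]
    (b : Module.Basis ι ℝ E) :
    ∀ᶠ x in 𝓝 (unitCoord E G), ∀ (h : G → ℂ) (g : G),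
      MDifferentiableAt 𝓘(ℝ, E) 𝓘(ℝ, ℂ) h (g * unitChartSymm G x) →
      HasFDerivAt (fun v => h (g * unitChartSymm G v))
        (∑ i, ((LinearMap.toContinuousLinearMap (b.coord i)).comp (localCoframe G x)).smulRight
          (leftDeriv (b i) h (g * unitChartSymm G x))) x := by
  filter_upwards [unitTarget_mem_nhds, eventually_localFrame_localCoframe] with x hx hco h g hh
  have h1 := (differentiableAt_unitChartSymm hx hh).hasFDerivAt
  convert h1 using 1
  ext v
  have h2 : v = localFrame G x (localCoframe G x v) := by
    rw [← ContinuousLinearMap.comp_apply, hco, ContinuousLinearMap.id_apply]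
  have h3 : ∀ w : E, leftDeriv w h (g * unitChartSymm G x) =
      ∑ i, b.repr w i • leftDeriv (b i) h (g * unitChartSymm G x) := by
    intro w
    conv_lhs => rw [← b.sum_repr w]
    simp only [leftDeriv, leftField, map_sum, map_smul]
  conv_rhs => rw [h2, fderiv_localFrame hx hh, h3]
  simp

variable [FiniteDimensional ℝ E]

/-- A differentiable function whose left-invariant derivatives are `C^n` is `C^(n+1)`. -/
theorem contMDiff_succ_of_leftDeriv {h : G → ℂ} (hh : MDifferentiable 𝓘(ℝ, E) 𝓘(ℝ, ℂ) h) {n : ℕ}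
    (hV : ∀ V : E, ContMDiff 𝓘(ℝ, E) 𝓘(ℝ, ℂ) n (leftDeriv V h)) :
    ContMDiff 𝓘(ℝ, E) 𝓘(ℝ, ℂ) (n + 1 : ℕ) h := by
  intro g
  have hle : ∀ k : ℕ, ((k : ℕ) : WithTop ℕ∞) ≤ ∞ := fun k => by exact_mod_cast le_top
  rw [contMDiffAt_iff_unitChartSymm (hle _), contMDiffAt_iff_contDiffAt]
  have hb := eventually_hasFDerivAt (G := G) (Module.finBasis ℝ E)
  push_cast
  rw [contDiffAt_succ_iff_hasFDerivAt]
  refine ⟨_, ⟨_, hb, fun x hx => hx h g (hh _)⟩, ?_⟩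
  refine ContDiffAt.sum fun i _ => ?_
  refine ContDiffAt.smulRight ?_ ?_
  · exact contDiffAt_const.clm_comp (contDiffAt_localCoframe.of_le (hle _))
  · rw [← contMDiffAt_iff_contDiffAt]
    exact (contMDiffAt_iff_unitChartSymm (hle _)).1 (hV _ g)

/-- Differentiation under the integral sign: the average of the translates of a function by a
compact family of central elements is differentiable, and averaging commutes with left-invariant
derivatives. -/
theorem leftDeriv_integral {A : Type*} [TopologicalSpace A] [CompactSpace A]
    [SecondCountableTopology A] [MeasurableSpace A] [BorelSpace A] (μ : Measure A)
    [IsFiniteMeasure μ] {a : A → G} (ha : ∀ θ g, a θ * g = g * a θ) (χ : C(A, ℂ)) {h : G → ℂ}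
    (hh : MDifferentiable 𝓘(ℝ, E) 𝓘(ℝ, ℂ) h) (hc : ∀ g, Continuous fun θ => h (g * a θ))
    (hVc : ∀ (V : E) (g : G), Continuous fun θ => leftDeriv V h (g * a θ))
    (hVb : ∀ V : E, ∃ C, ∀ g : G, ‖leftDeriv V h g‖ ≤ C) :
    MDifferentiable 𝓘(ℝ, E) 𝓘(ℝ, ℂ) (fun g => ∫ θ, χ θ * h (g * a θ) ∂μ) ∧
    ∀ (V : E) (g : G), leftDeriv V (fun g => ∫ θ, χ θ * h (g * a θ) ∂μ) g =
      ∫ θ, χ θ * leftDeriv V h (g * a θ) ∂μ := by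
  set b := Module.finBasis ℝ E with hb
  choose C hC using hVb
  have hright : ∀ θ, MDifferentiable 𝓘(ℝ, E) 𝓘(ℝ, ℂ) fun y => h (y * a θ) := fun θ y =>
    (hh (y * a θ)).comp y (mdiffAt_mul_right (E := E) (a θ) y)
  set cof : Fin (Module.finrank ℝ E) → E → E →L[ℝ] ℝ := fun i x =>
    (LinearMap.toContinuousLinearMap (b.coord i)).comp (localCoframe G x) with hcof
  have hcofc : ∀ i, ContinuousAt (cof i) (unitCoord E G) := fun i =>
    continuousAt_const.clm_comp contDiffAt_localCoframe.continuousAt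
  have hsum : ∀ g : G, Continuous fun θ => χ θ • ∑ i, (cof i (unitCoord E G)).smulRight
      (leftDeriv (b i) h (g * unitChartSymm G (unitCoord E G) * a θ)) := fun g =>
    χ.continuous.smul (continuous_finsetSum _ fun i _ =>
      ((ContinuousLinearMap.smulRightL ℝ E ℂ (cof i (unitCoord E G))).continuous.comp (hVc _ _)))
  have key : ∀ g : G, HasFDerivAt (fun v => ∫ θ, χ θ * h (g * unitChartSymm G v * a θ) ∂μ)
      (∫ θ, χ θ • ∑ i, (cof i (unitCoord E G)).smulRight
        (leftDeriv (b i) h (g * unitChartSymm G (unitCoord E G) * a θ)) ∂μ) (unitCoord E G) := by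
    intro g
    have hcofb : ∀ᶠ x in 𝓝 (unitCoord E G), ∀ i, ‖cof i x‖ ≤ ‖cof i (unitCoord E G)‖ + 1 := by
      rw [Filter.eventually_all]
      intro i
      exact (hcofc i).norm.eventually_le_const (by simp)
    refine hasFDerivAt_integral_of_dominated_of_fderiv_le
      (F' := fun x θ => χ θ • ∑ i, (cof i x).smulRight
        (leftDeriv (b i) h (g * unitChartSymm G x * a θ)))
      (bound := fun _ => ‖χ‖ * ∑ i, (‖cof i (unitCoord E G)‖ + 1) * C (b i))
      (hcofb.and (eventually_hasFDerivAt (G := G) b)) ?_ ?_ ?_ ?_ ?_ ?_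
    · exact Eventually.of_forall fun x => (χ.continuous.mul (hc _)).aestronglyMeasurable
    · exact (χ.continuous.mul (hc _)).integrable_of_hasCompactSupport
        (HasCompactSupport.of_compactSpace _)
    · exact (hsum g).aestronglyMeasurable
    · refine Eventually.of_forall fun θ x hx => ?_
      rw [norm_smul]
      refine mul_le_mul (χ.norm_coe_le_norm θ) ?_ (norm_nonneg _) (norm_nonneg _)
      refine (norm_sum_le _ _).trans (Finset.sum_le_sum fun i _ => ?_)
      rw [ContinuousLinearMap.norm_smulRight_apply]
      exact mul_le_mul (hx.1 i) (hC _ _) (norm_nonneg _) (by positivity)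
    · exact integrable_const _
    · refine Eventually.of_forall fun θ x hx => ?_
      have h1 := hx.2 (fun y => h (y * a θ)) g (hright θ _)
      simp only [leftDeriv_comp_mul_right hh (ha θ)] at h1
      exact h1.const_mul (χ θ)
  have hdiff : MDifferentiable 𝓘(ℝ, E) 𝓘(ℝ, ℂ) (fun g => ∫ θ, χ θ * h (g * a θ) ∂μ) :=
    fun g => mdifferentiableAt_of_unitChartSymm (key g).differentiableAt
  refine ⟨hdiff, fun V g => ?_⟩
  rw [leftDeriv_eq_fderiv (hdiff g), (key g).fderiv, ContinuousLinearMap.integral_apply]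
  · refine integral_congr_ae (Eventually.of_forall fun θ => ?_)
    have h1 := (eventually_hasFDerivAt (G := G) b).self_of_nhds (fun y => h (y * a θ)) g
      (hright θ _)
    have h2 := leftDeriv_eq_fderiv (hright θ g) V
    rw [h1.fderiv, leftDeriv_comp_mul_right hh (ha θ)] at h2
    simp only [leftDeriv_comp_mul_right hh (ha θ)] at h2
    exact congrArg (χ θ * ·) h2.symm
  · exact (hsum g).integrable_of_hasCompactSupport (HasCompactSupport.of_compactSpace _)

end LeftDeriv

/-! ### The quotient `Γ \ G` and its right action -/

namespace Nilmanifold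

open Filter Topology MeasureTheory

variable (N : Nilmanifold.{u})

/-- The model space of `G`, which is also the underlying space of its Lie algebra. -/
abbrev Model : Type := EuclideanSpace ℝ (Fin N.dim)

instance isTopologicalGroup : IsTopologicalGroup N.G := topologicalGroup_of_lieGroup (𝓡 N.dim) ∞

theorem isOpenQuotientMap_toSpace : IsOpenQuotientMap N.toSpace := by
  have h : IsOpenMap N.toSpace := isOpenMap_quotient_mk'_mul (Γ := N.Γ) (T := N.G)
  exact ⟨Quotient.mk_surjective, continuous_quotient_mk', h⟩

theorem toSpace_eq_iff {a b : N.G} : N.toSpace a = N.toSpace b ↔ b * a⁻¹ ∈ N.Γ := by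
  rw [← QuotientGroup.rightRel_apply]
  exact Quotient.eq

@[simp] theorem act_toSpace (g h : N.G) : N.act (N.toSpace g) h = N.toSpace (g * h) := rfl

theorem act_act (x : N.Space) (g h : N.G) : N.act (N.act x g) h = N.act x (g * h) := by
  obtain ⟨y, rfl⟩ := N.isOpenQuotientMap_toSpace.surjective x
  simp [mul_assoc]

theorem continuous_act : Continuous fun p : N.Space × N.G => N.act p.1 p.2 := by
  have h := N.isOpenQuotientMap_toSpace.prodMap (IsOpenQuotientMap.id (X := N.G))
  rw [h.isQuotientMap.continuous_iff]
  exact N.isOpenQuotientMap_toSpace.continuous.comp continuous_mul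

/-- The central elements of the lattice act trivially. -/
theorem act_of_mem (x : N.Space) {γ : N.G} (hγ : γ ∈ N.Γ) (hc : ∀ g, γ * g = g * γ) :
    N.act x γ = x := by
  obtain ⟨y, rfl⟩ := N.isOpenQuotientMap_toSpace.surjective x
  rw [act_toSpace, ← hc, eq_comm, toSpace_eq_iff]
  simpa using hγ

/-- Integral curves through `1` exist and are unique, so the defining choice is the flow. -/
theorem isExponential_exp : IsExponential (E := N.Model) N.exp := by
  have key : ∀ V : N.Model, ∃ γ : ℝ → N.G, γ 0 = 1 ∧ IsLeftCurve V γ ∧ N.exp V = γ 1 := by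
    intro V
    have h : ∃ γ : ℝ → N.G, γ 0 = 1 ∧
      IsMIntegralCurve (I := 𝓡 N.dim) γ (mulInvariantVectorField (I := 𝓡 N.dim) V) :=
      exists_isLeftCurve N.G V
    exact ⟨h.choose, h.choose_spec.1, h.choose_spec.2, dif_pos h⟩
  have hexp : ∀ (V : N.Model) (γ : ℝ → N.G), γ 0 = 1 → IsLeftCurve V γ →
      ∀ t : ℝ, N.exp (t • V) = γ t := by
    intro V γ h0 hγ t
    obtain ⟨δ, hδ0, hδ, hδe⟩ := key (t • V)
    have h := hδ.eq (hγ.comp_mul t) (by simp [hδ0, h0])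
    simp [hδe, h]
  constructor
  · obtain ⟨γ, h0, hγ⟩ := exists_isLeftCurve N.G (0 : N.Model)
    simpa [h0] using hexp 0 γ h0 hγ 0
  · intro V
    obtain ⟨γ, h0, hγ⟩ := exists_isLeftCurve N.G V
    have e : (fun t : ℝ => N.exp (t • V)) = γ := funext (hexp V γ h0 hγ)
    exact e ▸ hγ

theorem isBiInvariant_of_mem_center {V : N.LieAlg}
    (hV : V ∈ LieAlgebra.center ℝ N.LieAlg) : IsBiInvariant (E := N.Model) N.G V :=
  isBiInvariant_of_leftBracket_eq_zero fun W =>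
    (LieModule.mem_maxTrivSubmodule (R := ℝ) (L := N.LieAlg) (M := N.LieAlg) V).1 hV W

theorem isBiInvariant_of_comm (h : ∀ a b : N.G, a * b = b * a) (V : N.Model) :
    IsBiInvariant N.G V := by
  intro g
  simp only [h _ g]
  rfl

/-! ### Smooth functions -/

/-- The space of smooth functions on `Γ \ G`, as a subspace of the continuous functions. -/
def smoothSubmodule : Submodule ℂ C(N.Space, ℂ) where
  carrier := {f | ContMDiff (𝓡 N.dim) 𝓘(ℝ, ℂ) ∞ fun g : N.G => f (N.toSpace g)}
  zero_mem' := contMDiff_const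
  add_mem' := fun hf hg => hf.add hg
  smul_mem' := fun a _ hf =>
    (contDiff_const_smul a : ContDiff ℝ ∞ fun z : ℂ => a • z).contMDiff.comp hf

variable {N}

theorem contMDiff_toSpace (f : N.smoothSubmodule) :
    ContMDiff (𝓡 N.dim) 𝓘(ℝ, ℂ) ∞ fun g : N.G => f.1 (N.toSpace g) := f.2

theorem mdifferentiable_toSpace (f : N.smoothSubmodule) :
    MDifferentiable (𝓡 N.dim) 𝓘(ℝ, ℂ) fun g : N.G => f.1 (N.toSpace g) :=
  f.2.mdifferentiable (by simp)

theorem leftDeriv_eq_of_rel (f : N.smoothSubmodule) (V : N.Model) {a b : N.G}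
    (h : N.toSpace a = N.toSpace b) : leftDeriv V (fun g => f.1 (N.toSpace g)) a =
      leftDeriv V (fun g => f.1 (N.toSpace g)) b := by
  rw [toSpace_eq_iff] at h
  have h1 := leftDeriv_comp_mul_left (mdifferentiable_toSpace f) (b * a⁻¹) V a
  have h2 : ∀ y, N.toSpace (b * a⁻¹ * y) = N.toSpace y := fun y => by
    rw [eq_comm, toSpace_eq_iff]
    simpa using h
  simp only [h2, inv_mul_cancel_right] at h1
  exact h1

/-- The derivative of a smooth function along a left-invariant vector field, as a smooth function on
`Γ \ G`. -/
noncomputable def smoothDeriv (V : N.Model) (f : N.smoothSubmodule) : N.smoothSubmodule :=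
  ⟨⟨Quotient.lift (leftDeriv V fun g => f.1 (N.toSpace g))
      fun _ _ h => leftDeriv_eq_of_rel f V (Quotient.sound h),
    (contMDiff_leftDeriv (contMDiff_toSpace f) V).continuous.quotient_lift _⟩,
    contMDiff_leftDeriv (contMDiff_toSpace f) V⟩

theorem smoothDeriv_toSpace (V : N.Model) (f : N.smoothSubmodule) (g : N.G) :
    (smoothDeriv V f).1 (N.toSpace g) = leftDeriv V (fun g => f.1 (N.toSpace g)) g := rfl

theorem smoothDeriv_add (V : N.Model) (f g : N.smoothSubmodule) :
    smoothDeriv V (f + g) = smoothDeriv V f + smoothDeriv V g := by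
  ext x
  obtain ⟨y, rfl⟩ := N.isOpenQuotientMap_toSpace.surjective x
  have hf := mdifferentiable_toSpace f y
  have hg := mdifferentiable_toSpace g y
  have h := leftDeriv_eq_fderiv (mdifferentiable_toSpace (f + g) y) V
  have h1 := differentiableAt_unitChartSymm (g := y) (h := fun g : N.G => f.1 (N.toSpace g))
    (unitCoord_mem (E := N.Model)) (by simpa using hf)
  have h2 := differentiableAt_unitChartSymm (g := y) (h := fun y : N.G => g.1 (N.toSpace y))
    (unitCoord_mem (E := N.Model)) (by simpa using hg)
  rw [smoothDeriv_toSpace, h]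
  change _ = (smoothDeriv V f).1 (N.toSpace y) + (smoothDeriv V g).1 (N.toSpace y)
  rw [smoothDeriv_toSpace, smoothDeriv_toSpace, leftDeriv_eq_fderiv hf, leftDeriv_eq_fderiv hg,
    ← _root_.add_apply, ← fderiv_add h1 h2]
  rfl

theorem smoothDeriv_smul (V : N.Model) (a : ℂ) (f : N.smoothSubmodule) :
    smoothDeriv V (a • f) = a • smoothDeriv V f := by
  ext x
  obtain ⟨y, rfl⟩ := N.isOpenQuotientMap_toSpace.surjective x
  have hf := mdifferentiable_toSpace f y
  have h := leftDeriv_eq_fderiv (mdifferentiable_toSpace (a • f) y) V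
  have h1 := differentiableAt_unitChartSymm (g := y) (h := fun g : N.G => f.1 (N.toSpace g))
    (unitCoord_mem (E := N.Model)) (by simpa using hf)
  rw [smoothDeriv_toSpace, h]
  change _ = a • (smoothDeriv V f).1 (N.toSpace y)
  rw [smoothDeriv_toSpace, leftDeriv_eq_fderiv hf, ← _root_.smul_apply, ← fderiv_const_smul h1]
  rfl

/-- The iterated derivative `V₁ (V₂ (⋯ f))` of a smooth function along a list of left-invariant
vector fields, as a linear endomorphism of the space of smooth functions. -/
noncomputable def smoothIterDeriv : List N.Model → (N.smoothSubmodule →ₗ[ℂ] N.smoothSubmodule)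
  | [] => LinearMap.id
  | V :: l => (⟨⟨smoothDeriv V, smoothDeriv_add V⟩, smoothDeriv_smul V⟩ :
      N.smoothSubmodule →ₗ[ℂ] N.smoothSubmodule).comp (smoothIterDeriv l)

theorem smoothIterDeriv_cons (V : N.Model) (l : List N.Model) (f : N.smoothSubmodule) :
    smoothIterDeriv (V :: l) f = smoothDeriv V (smoothIterDeriv l f) := rfl

theorem iterDeriv_eq (l : List N.Model) (f : N.smoothSubmodule) :
    N.iterDeriv l (fun g => f.1 (N.toSpace g)) =
      fun g => (smoothIterDeriv l f).1 (N.toSpace g) := by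
  induction l with
  | nil => rfl
  | cons V l ih =>
    funext g
    rw [smoothIterDeriv_cons, smoothDeriv_toSpace, ← ih]
    rfl

/-- A function is smooth if it belongs to a family of differentiable functions that is stable under
left-invariant derivatives. -/
theorem mem_smoothSubmodule_of_family (S : Set C(N.Space, ℂ))
    (hS : ∀ f ∈ S, MDifferentiable (𝓡 N.dim) 𝓘(ℝ, ℂ) (fun g : N.G => f (N.toSpace g)) ∧
      ∀ V : N.Model, ∃ f' ∈ S, ∀ g : N.G,
        leftDeriv V (fun g => f (N.toSpace g)) g = f' (N.toSpace g))
    {f : C(N.Space, ℂ)} (hf : f ∈ S) : f ∈ N.smoothSubmodule := by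
  suffices h : ∀ (n : ℕ) (f : C(N.Space, ℂ)), f ∈ S →
      ContMDiff (𝓡 N.dim) 𝓘(ℝ, ℂ) n (fun g : N.G => f (N.toSpace g)) from
    contMDiff_infty.2 fun n => h n f hf
  intro n
  induction n with
  | zero =>
    intro f _
    exact contMDiff_zero_iff.2 (f.continuous.comp N.isOpenQuotientMap_toSpace.continuous)
  | succ n ih =>
    intro f hf
    refine contMDiff_succ_of_leftDeriv (hS f hf).1 fun V => ?_
    obtain ⟨f', hf', h⟩ := (hS f hf).2 V
    have e : leftDeriv V (fun g : N.G => f (N.toSpace g)) = fun g => f' (N.toSpace g) := funext h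
    rw [e]
    exact ih f' hf'

end Nilmanifold

/-! ### Averages over families of central elements -/

namespace Nilmanifold

open Filter Topology MeasureTheory

/-- A family of central elements of `G`, indexed by a space `A`, whose right action on `Γ \ G` is
jointly continuous. (The family itself need not be continuous.) -/
structure CentralFamily (N : Nilmanifold.{u}) (A : Type*) [TopologicalSpace A] where
  /-- the family of group elements -/
  toFun : A → N.G
  central : ∀ θ g, toFun θ * g = g * toFun θ
  continuous_act : Continuous fun p : N.Space × A => N.act p.1 (toFun p.2)

namespace CentralFamily

variable {N : Nilmanifold.{u}} {A : Type*} [TopologicalSpace A] (a : CentralFamily N A)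

/-- The orbit of a continuous function under a central family. -/
noncomputable def orbit (f : C(N.Space, ℂ)) : C(N.Space, C(A, ℂ)) :=
  ContinuousMap.curry ⟨fun p : N.Space × A => f (N.act p.1 (a.toFun p.2)),
    f.continuous.comp a.continuous_act⟩

theorem continuous_weighted (χ : C(A, ℂ)) (f : C(N.Space, ℂ)) (x : N.Space) :
    Continuous fun θ => χ θ * f (N.act x (a.toFun θ)) :=
  χ.continuous.mul (a.orbit f x).continuous

theorem norm_integral_mul_le [CompactSpace A] [MeasurableSpace A] (μ : Measure A)
    [IsProbabilityMeasure μ] (χ k : C(A, ℂ)) : ‖∫ θ, χ θ * k θ ∂μ‖ ≤ ‖χ‖ * ‖k‖ := by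
  refine (norm_integral_le_of_norm_le_const (C := ‖χ‖ * ‖k‖)
    (Eventually.of_forall fun θ => ?_)).trans (by simp)
  rw [norm_mul]
  exact mul_le_mul (χ.norm_coe_le_norm θ) (k.norm_coe_le_norm θ) (norm_nonneg _) (norm_nonneg _)

variable [CompactSpace A] [MeasurableSpace A] [BorelSpace A] (μ : Measure A)
  [IsProbabilityMeasure μ]

theorem integrable_of_continuous {k : A → ℂ} (hk : Continuous k) : Integrable k μ :=
  hk.integrable_of_hasCompactSupport (HasCompactSupport.of_compactSpace _)

/-- The average of the translates of a continuous function by a central family, weighted by `χ`. -/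
noncomputable def avg (χ : C(A, ℂ)) (f : C(N.Space, ℂ)) : C(N.Space, ℂ) where
  toFun x := ∫ θ, χ θ * f (N.act x (a.toFun θ)) ∂μ
  continuous_toFun := by
    have h : Continuous fun k : C(A, ℂ) => ∫ θ, χ θ * k θ ∂μ := by
      refine (LipschitzWith.of_dist_le_mul (K := ‖χ‖₊) fun k k' => ?_).continuous
      have h1 (k : C(A, ℂ)) : Integrable (fun θ => χ θ * k θ) μ :=
        integrable_of_continuous μ (χ.continuous.mul k.continuous)
      rw [dist_eq_norm, dist_eq_norm, ← integral_sub (h1 k) (h1 k')]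
      simp only [← mul_sub]
      exact norm_integral_mul_le μ χ (k - k')
    exact h.comp (a.orbit f).continuous

theorem avg_apply (χ : C(A, ℂ)) (f : C(N.Space, ℂ)) (x : N.Space) :
    a.avg μ χ f x = ∫ θ, χ θ * f (N.act x (a.toFun θ)) ∂μ := rfl

/-- Averaging, as a linear map in the weight. -/
noncomputable def avgLinear (f : C(N.Space, ℂ)) : C(A, ℂ) →ₗ[ℂ] C(N.Space, ℂ) where
  toFun χ := a.avg μ χ f
  map_add' χ χ' := by
    ext x
    simp only [avg_apply, ContinuousMap.add_apply, add_mul]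
    exact integral_add (integrable_of_continuous μ (a.continuous_weighted χ f x))
      (integrable_of_continuous μ (a.continuous_weighted χ' f x))
  map_smul' c χ := by
    ext x
    simp only [avg_apply, ContinuousMap.smul_apply, smul_eq_mul, mul_assoc, RingHom.id_apply]
    exact integral_const_mul _ _

theorem norm_avg_le (χ : C(A, ℂ)) (f : C(N.Space, ℂ)) : ‖a.avg μ χ f‖ ≤ ‖χ‖ * ‖f‖ := by
  rw [ContinuousMap.norm_le _ (by positivity)]
  intro x
  refine (norm_integral_mul_le μ χ (a.orbit f x)).trans ?_
  refine mul_le_mul_of_nonneg_left ?_ (norm_nonneg _)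
  rw [ContinuousMap.norm_le _ (norm_nonneg _)]
  exact fun θ => f.norm_coe_le_norm _

/-- A family containing an element that acts trivially admits approximate identities with weights in
any dense space of weights. -/
theorem exists_avg_approx [T2Space A] [μ.IsOpenPosMeasure] (D : Submodule ℂ C(A, ℂ))
    (hD : D.topologicalClosure = ⊤) {θ₀ : A} (hθ₀ : ∀ x, N.act x (a.toFun θ₀) = x)
    (s : Finset C(N.Space, ℂ)) {ε : ℝ} (hε : 0 < ε) :
    ∃ χ ∈ D, ∀ f ∈ s, ‖a.avg μ χ f - f‖ < ε := by
  -- the translates by parameters in a neighbourhood `U` of `θ₀` are uniformly close to the function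
  set swap : C(N.Space, ℂ) → C(A, C(N.Space, ℂ)) := fun f => ContinuousMap.curry
    ⟨fun p : A × N.Space => f (N.act p.2 (a.toFun p.1)),
      f.continuous.comp (a.continuous_act.comp continuous_swap)⟩ with hswap
  set U : Set A := {θ | ∀ f ∈ s, ‖swap f θ - f‖ < ε / 4} with hU
  have hUo : IsOpen U := by
    have : U = ⋂ f ∈ s, {θ | ‖swap f θ - f‖ < ε / 4} := by ext; simp [hU]
    rw [this]
    exact isOpen_biInter_finset fun f _ =>
      isOpen_lt ((swap f).continuous.sub continuous_const).norm continuous_const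
  have hUθ : θ₀ ∈ U := by
    intro f _
    have : swap f θ₀ = f := by
      ext x
      simp [hswap, hθ₀]
    rw [this, sub_self, norm_zero]
    positivity
  -- a bump function at `θ₀` supported in `U`, normalised, then replaced by a nearby element of `D`
  obtain ⟨ψ, hψ1, hψ0, -, hψI⟩ := exists_continuous_one_zero_of_isCompact
    (isCompact_singleton (x := θ₀)) hUo.isClosed_compl (by simpa using hUθ)
  have hψn : ∀ θ, 0 ≤ ψ θ := fun θ => (hψI θ).1
  have hψi : Integrable (fun θ => ψ θ) μ :=
    ψ.continuous.integrable_of_hasCompactSupport (HasCompactSupport.of_compactSpace _)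
  have hpos : 0 < ∫ θ, ψ θ ∂μ :=
    ψ.continuous.integral_pos_of_hasCompactSupport_nonneg_nonzero
      (HasCompactSupport.of_compactSpace _) hψn (x := θ₀) (by rw [hψ1 (by simp)]; simp)
  set m := ∫ θ, ψ θ ∂μ with hm
  set ψ' : C(A, ℂ) := ⟨fun θ => ((ψ θ / m : ℝ) : ℂ), by fun_prop⟩ with hψ'
  have hψavg : ∀ f ∈ s, ‖a.avg μ ψ' f - f‖ ≤ ε / 4 := by
    intro f hf
    rw [ContinuousMap.norm_le _ (by positivity)]
    intro x
    have h1 : f x = ∫ θ, ψ' θ * f x ∂μ := by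
      rw [integral_mul_const]
      simp only [hψ', ContinuousMap.coe_mk]
      rw [integral_complex_ofReal, integral_div, ← hm, div_self hpos.ne']
      simp
    have i1 : Integrable (fun θ => ψ' θ * f x) μ :=
      integrable_of_continuous μ (ψ'.continuous.mul continuous_const)
    rw [ContinuousMap.sub_apply, avg_apply, h1, ← integral_sub
      (integrable_of_continuous μ (a.continuous_weighted ψ' f x)) i1]
    have h2 : ∀ θ, ‖ψ' θ * f (N.act x (a.toFun θ)) - ψ' θ * f x‖ ≤ ψ θ / m * (ε / 4) := by
      intro θ
      rw [← mul_sub, norm_mul]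
      have h3 : ‖ψ' θ‖ = ψ θ / m := by
        simp only [hψ', ContinuousMap.coe_mk, Complex.norm_real, Real.norm_eq_abs]
        exact abs_of_nonneg (div_nonneg (hψn θ) hpos.le)
      rw [h3]
      by_cases hθ : θ ∈ U
      · refine mul_le_mul_of_nonneg_left ?_ (div_nonneg (hψn θ) hpos.le)
        exact ((swap f θ - f).norm_coe_le_norm x).trans (hθ f hf).le
      · rw [hψ0 hθ]
        simp
    refine (norm_integral_le_of_norm_le ((hψi.div_const m).mul_const (ε / 4))
      (Eventually.of_forall h2)).trans ?_
    rw [integral_mul_const, integral_div, ← hm, div_self hpos.ne', one_mul]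
  -- a common bound for the functions, made positive
  set B : ℝ := ∑ f ∈ s, ‖f‖ + 1 with hB
  have hBpos : 0 < B := by positivity
  obtain ⟨χ, hχ, hdist⟩ := Metric.mem_closure_iff.1
    (show ψ' ∈ closure (D : Set C(A, ℂ)) by
      rw [← Submodule.topologicalClosure_coe, hD]; trivial) (ε / (4 * B)) (by positivity)
  refine ⟨χ, hχ, fun f hf => ?_⟩
  have hfB : ‖f‖ ≤ B := by
    have := Finset.single_le_sum (f := fun f : C(N.Space, ℂ) => ‖f‖)
      (fun _ _ => norm_nonneg _) hf
    linarith
  have h4 : a.avg μ χ f - f = a.avg μ (χ - ψ') f + (a.avg μ ψ' f - f) := by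
    have := (a.avgLinear μ f).map_sub χ ψ'
    change a.avg μ (χ - ψ') f = a.avg μ χ f - a.avg μ ψ' f at this
    rw [this]
    abel
  rw [h4]
  have h5 : ‖a.avg μ (χ - ψ') f‖ ≤ ε / 4 := by
    refine (a.norm_avg_le μ _ f).trans ?_
    rw [dist_comm, dist_eq_norm] at hdist
    calc ‖χ - ψ'‖ * ‖f‖ ≤ ε / (4 * B) * B :=
          mul_le_mul hdist.le hfB (norm_nonneg _) (by positivity)
      _ = ε / 4 := by field_simp
  exact (norm_add_le _ _).trans_lt (by linarith [hψavg f hf])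

variable [SecondCountableTopology A]

theorem avg_differentiable (χ : C(A, ℂ)) (f : N.smoothSubmodule) :
    MDifferentiable (𝓡 N.dim) 𝓘(ℝ, ℂ) (fun g : N.G => a.avg μ χ f.1 (N.toSpace g)) ∧
    ∀ (V : N.Model) (g : N.G), leftDeriv V (fun g => a.avg μ χ f.1 (N.toSpace g)) g =
      a.avg μ χ (smoothDeriv V f).1 (N.toSpace g) :=
  leftDeriv_integral μ a.central χ (mdifferentiable_toSpace f)
    (fun g => (a.orbit f.1 (N.toSpace g)).continuous)
    (fun V g => (a.orbit (smoothDeriv V f).1 (N.toSpace g)).continuous)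
    (fun V => ⟨‖(smoothDeriv V f).1‖, fun g => (smoothDeriv V f).1.norm_coe_le_norm (N.toSpace g)⟩)

theorem avg_mem_smoothSubmodule (χ : C(A, ℂ)) (f : N.smoothSubmodule) :
    a.avg μ χ f.1 ∈ N.smoothSubmodule := by
  refine mem_smoothSubmodule_of_family (Set.range fun f : N.smoothSubmodule => a.avg μ χ f.1)
    ?_ ⟨f, rfl⟩
  rintro _ ⟨f, rfl⟩
  exact ⟨(a.avg_differentiable μ χ f).1, fun V =>
    ⟨_, ⟨smoothDeriv V f, rfl⟩, (a.avg_differentiable μ χ f).2 V⟩⟩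

/-- Averaging of smooth functions. -/
noncomputable def smoothAvg (χ : C(A, ℂ)) (f : N.smoothSubmodule) : N.smoothSubmodule :=
  ⟨a.avg μ χ f.1, a.avg_mem_smoothSubmodule μ χ f⟩

theorem smoothIterDeriv_smoothAvg (χ : C(A, ℂ)) (l : List N.Model) (f : N.smoothSubmodule) :
    smoothIterDeriv l (a.smoothAvg μ χ f) = a.smoothAvg μ χ (smoothIterDeriv l f) := by
  induction l with
  | nil => rfl
  | cons V l ih =>
    rw [smoothIterDeriv_cons, ih, smoothIterDeriv_cons]
    ext x
    obtain ⟨y, rfl⟩ := N.isOpenQuotientMap_toSpace.surjective x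
    exact (a.avg_differentiable μ χ (smoothIterDeriv l f)).2 V y

end CentralFamily

end Nilmanifold

/-! ### Relatively dense subgroups and functions on the torus -/

/-- A subgroup of a normed space which is relatively dense spans the space. -/
theorem span_eq_top_of_relativelyDense {E : Type*} [NormedAddCommGroup E] [NormedSpace ℝ E]
    [FiniteDimensional ℝ E] {Λ : Set E} {R : ℝ} (h : ∀ t : E, ∃ s, ‖s‖ ≤ R ∧ t - s ∈ Λ) :
    Submodule.span ℝ Λ = ⊤ := by
  by_contra hne
  obtain ⟨f, hf0, hf⟩ := Submodule.exists_le_ker_of_lt_top _ (lt_top_iff_ne_top.2 hne)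
  obtain ⟨x, hx⟩ : ∃ x, f x ≠ 0 := by
    by_contra! hx
    exact hf0 (LinearMap.ext hx)
  -- `f` is unbounded along `ℝ x`, but takes the same values as on the ball of radius `R`
  set F := LinearMap.toContinuousLinearMap f with hF
  set a : ℝ := (‖F‖ * R + 1) / f x with ha
  obtain ⟨s, hs, hs'⟩ := h (a • x)
  have h1 : f (a • x) = f s := by
    have := hf (Submodule.subset_span hs')
    rw [LinearMap.mem_ker, map_sub, sub_eq_zero] at this
    exact this
  have h2 : f (a • x) = ‖F‖ * R + 1 := by
    rw [map_smul, smul_eq_mul, ha, div_mul_cancel₀ _ hx]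
  have h3 : f s ≤ ‖F‖ * R := (le_abs_self _).trans
    ((F.le_opNorm s).trans (mul_le_mul_of_nonneg_left hs (norm_nonneg _)))
  linarith

/-- The expansion of an element of a submodule in a basis of it. -/
theorem sum_repr_smul_coe {R M ι : Type*} [Ring R] [AddCommGroup M] [Module R M] [Fintype ι]
    {z : Submodule R M} (b : Module.Basis ι R z) (t : z) :
    ∑ i, b.repr t i • (b i : M) = t := by
  have h := congrArg z.subtype (b.sum_repr t)
  rwa [map_sum] at h

/-- The quotient map from `ℝ^ι` to the torus. -/
def toUnitAddTorus {ι : Type*} (t : ι → ℝ) : UnitAddTorus ι := fun i => (t i : UnitAddCircle)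

theorem isOpenQuotientMap_toUnitAddTorus {ι : Type*} [Finite ι] :
    IsOpenQuotientMap (toUnitAddTorus (ι := ι)) := by
  refine ⟨fun θ => ?_, by unfold toUnitAddTorus; fun_prop, ?_⟩
  · choose t ht using fun i => QuotientAddGroup.mk_surjective (θ i)
    exact ⟨t, funext ht⟩
  · exact IsOpenMap.piMap (fun _ => QuotientAddGroup.isOpenMap_coe)
      (Filter.Eventually.of_forall fun _ => QuotientAddGroup.mk_surjective)

theorem toUnitAddTorus_eq_iff {ι : Type*} {s t : ι → ℝ} :
    toUnitAddTorus s = toUnitAddTorus t ↔ ∀ i, ∃ n : ℤ, s i - t i = n := by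
  rw [funext_iff]
  refine forall_congr' fun i => ?_
  rw [toUnitAddTorus, toUnitAddTorus, ← sub_eq_zero, ← AddCircle.coe_sub,
    AddCircle.coe_eq_zero_iff]
  simp [eq_comm]

theorem mFourier_toUnitAddTorus {ι : Type*} [Fintype ι] (m : ι → ℤ) (t : ι → ℝ) :
    UnitAddTorus.mFourier m (toUnitAddTorus t) =
      Complex.exp (2 * Real.pi * Complex.I * ((∑ i, (m i : ℝ) * t i : ℝ) : ℂ)) := by
  simp only [UnitAddTorus.mFourier, ContinuousMap.coe_mk, toUnitAddTorus, fourier_coe_apply]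
  rw [← Complex.exp_sum]
  congr 1
  push_cast
  rw [Finset.mul_sum]
  exact Finset.sum_congr rfl fun i _ => by ring

theorem mFourier_add_apply {ι : Type*} [Fintype ι] (m : ι → ℤ) (s t : UnitAddTorus ι) :
    UnitAddTorus.mFourier m (s + t) =
      UnitAddTorus.mFourier m s * UnitAddTorus.mFourier m t := by
  simp [UnitAddTorus.mFourier, Finset.prod_mul_distrib, AddCircle.toCircle_add]

/-- The linear form with given coefficients in the dual of a basis. -/
noncomputable def coordForm {F ι : Type*} [Fintype ι] [AddCommGroup F] [Module ℝ F]
    (b : Module.Basis ι ℝ F) (a : ι → ℝ) : F →ₗ[ℝ] ℝ := ∑ i, a i • b.coord i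

theorem coordForm_apply {F ι : Type*} [Fintype ι] [AddCommGroup F] [Module ℝ F]
    (b : Module.Basis ι ℝ F) (a : ι → ℝ) (t : F) : coordForm b a t = ∑ i, a i * b.repr t i := by
  simp [coordForm]

/-! ### The lattice `{t ∈ z | exp t ∈ Γ}` -/

namespace Nilmanifold

open Filter Topology MeasureTheory

variable {N : Nilmanifold.{u}} {z : Submodule ℝ N.Model}
  (hz : ∀ V ∈ z, IsBiInvariant (E := N.Model) N.G V)
include hz

theorem exp_add_of_mem (s t : z) :
    N.exp ((s + t : z) : N.Model) = N.exp (s : N.Model) * N.exp (t : N.Model) :=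
  N.isExponential_exp.add (hz s s.2)

theorem exp_mul_comm (t : z) (g : N.G) : N.exp (t : N.Model) * g = g * N.exp (t : N.Model) :=
  N.isExponential_exp.mul_comm (hz t t.2) g

theorem continuous_exp_coe : Continuous fun t : z => N.exp (t : N.Model) := by
  set b := Module.finBasis ℝ z
  have h := (N.isExponential_exp.contMDiff_sum (v := fun i => (b i : N.Model))
    fun i => hz _ (b i).2).continuous.comp b.equivFunL.continuous
  convert h using 2 with t
  rw [Function.comp_apply]
  exact congrArg N.exp (sum_repr_smul_coe b t).symm

theorem eventually_eq_zero_of_exp_eq_one :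
    ∀ᶠ t : z in 𝓝 0, N.exp (t : N.Model) = 1 → t = 0 := by
  set b := Module.finBasis ℝ z
  have hli : LinearIndependent ℝ fun i => (b i : N.Model) :=
    b.linearIndependent.map' z.subtype z.ker_subtype
  have h := N.isExponential_exp.eventually_ne_one (v := fun i => (b i : N.Model))
    (fun i => hz _ (b i).2) hli
  rw [eventually_nhdsWithin_iff] at h
  have hc : Tendsto b.equivFunL (𝓝 0) (𝓝 0) := by
    simpa using b.equivFunL.continuous.tendsto 0
  filter_upwards [hc.eventually h] with t ht h1
  by_contra hne
  refine ht (by simpa using hne) ?_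
  rw [← h1]
  exact congrArg N.exp (sum_repr_smul_coe b t)

/-- The exponential map of a subspace of bi-invariant vectors, as a homomorphism. -/
noncomputable def expHom : Multiplicative z →* N.G where
  toFun t := N.exp ((t.toAdd : z) : N.Model)
  map_one' := N.isExponential_exp.zero
  map_mul' s t := exp_add_of_mem hz s.toAdd t.toAdd

/-- The lattice `{t ∈ z | exp t ∈ Γ}`. -/
noncomputable def expLattice : Submodule ℤ z :=
  AddSubgroup.toIntSubmodule (Subgroup.toAddSubgroup' (N.Γ.comap (expHom hz)))

theorem mem_expLattice {t : z} : t ∈ expLattice hz ↔ N.exp (t : N.Model) ∈ N.Γ := Iff.rfl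

instance discreteTopology_expLattice : DiscreteTopology (expLattice hz) := by
  refine discreteTopology_of_isOpen_singleton_zero ?_
  obtain ⟨U, hU, hUΓ⟩ : ∃ U ∈ 𝓝 (1 : N.G), ∀ γ ∈ N.Γ, γ ∈ U → γ = 1 := by
    obtain ⟨U, hU, h⟩ := mem_nhds_subtype _ _ _ |>.1
      ((isOpen_discrete ({1} : Set N.Γ)).mem_nhds (Set.mem_singleton _))
    exact ⟨U, hU, fun γ hγ hγU => congrArg Subtype.val (h (show (⟨γ, hγ⟩ : N.Γ) ∈ _ from hγU))⟩
  have h0 : Tendsto (fun t : z => N.exp (t : N.Model)) (𝓝 0) (𝓝 1) := by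
    simpa [N.isExponential_exp.zero] using (continuous_exp_coe hz).tendsto 0
  have h1 : ∀ᶠ t : z in 𝓝 0, t ∈ expLattice hz → t = 0 := by
    filter_upwards [h0.eventually hU, eventually_eq_zero_of_exp_eq_one hz] with t ht h ht'
    exact h (hUΓ _ ht' ht)
  have h2 : {(0 : expLattice hz)} ∈ 𝓝 0 := by
    filter_upwards [continuous_subtype_val.tendsto (0 : expLattice hz) |>.eventually h1] with t ht
    exact Subtype.ext (ht t.2)
  rw [isOpen_singleton_iff_nhds_eq_pure]
  exact le_antisymm (le_pure_iff.2 h2) (pure_le_nhds _)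

/-- If the lattice is relatively dense, it is the integer span of a basis of `z`. -/
theorem exists_lattice_basis {R : ℝ}
    (hR : ∀ t : z, ∃ s : z, ‖s‖ ≤ R ∧ N.exp ((t - s : z) : N.Model) ∈ N.Γ) :
    ∃ (d : ℕ) (b : Module.Basis (Fin d) ℝ z), ∀ t : z, N.exp (t : N.Model) ∈ N.Γ ↔
      ∀ i, ∃ n : ℤ, b.repr t i = n := by
  have : IsZLattice ℝ (expLattice hz) := ⟨span_eq_top_of_relativelyDense hR⟩
  have : Module.Finite ℤ (expLattice hz) := ZLattice.module_finite ℝ _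
  have : Module.Free ℤ (expLattice hz) := ZLattice.module_free ℝ _
  set b := Module.finBasis ℤ (expLattice hz)
  refine ⟨_, b.ofZLatticeBasis ℝ, fun t => ?_⟩
  have h := (b.ofZLatticeBasis ℝ).mem_span_iff_repr_mem (R := ℤ) t
  rw [b.ofZLatticeBasis_span ℝ, mem_expLattice] at h
  simpa [eq_comm] using h

/-- Let `K = exp z` be closed. If `Γ K` is closed and `K` is open in it, then `Γ ∩ K` is cocompact
in `K`: the image of `K` in `Γ \ G` is compact, and the images of the sets `exp B`, with `B` a ball of
`z`, form an open cover of it. -/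
theorem exists_relativelyDense {K : Set N.G} (hK : K = N.exp '' (z : Set N.Model))
    (hKc : IsClosed K) (hΓK : IsClosed {g | ∃ γ ∈ N.Γ, γ * g ∈ K}) {U : Set N.G} (hU : IsOpen U)
    (hKU : K ⊆ U) (hUK : ∀ g ∈ U, ∀ γ ∈ N.Γ, γ * g ∈ K → g ∈ K) :
    ∃ R : ℝ, ∀ t : z, ∃ s : z, ‖s‖ ≤ R ∧ N.exp ((t - s : z) : N.Model) ∈ N.Γ := by
  have hKr : ((expHom hz).range : Set N.G) = K := by
    rw [hK]
    ext g
    simp only [MonoidHom.coe_range, Set.mem_range]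
    exact ⟨fun ⟨t, ht⟩ => ⟨_, t.toAdd.2, ht⟩, fun ⟨V, hV, h⟩ => ⟨.ofAdd ⟨V, hV⟩, h⟩⟩
  have hmem : ∀ t : z, N.exp (t : N.Model) ∈ K := fun t => hK ▸ ⟨_, t.2, rfl⟩
  have : LocallyCompactSpace N.G := ChartedSpace.locallyCompactSpace N.Model N.G
  have hKc' : IsClosed ((expHom hz).range : Set N.G) := hKr ▸ hKc
  have : LocallyCompactSpace (expHom hz).range :=
    hKc'.isClosedEmbedding_subtypeVal.locallyCompactSpace
  have : SigmaCompactSpace (Multiplicative z) := inferInstanceAs (SigmaCompactSpace z)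
  -- by the open mapping theorem, `exp` maps open balls of `z` to open subsets of `K`
  have hopen : IsOpenMap (expHom hz).rangeRestrict :=
    MonoidHom.isOpenMap_of_sigmaCompact _ (expHom hz).rangeRestrict_surjective
      (Continuous.subtype_mk (continuous_exp_coe hz) _)
  have hW : ∀ n : ℕ, ∃ W : Set N.G, IsOpen W ∧ ∀ g, g ∈ W ∧ g ∈ K ↔
      ∃ s : z, ‖s‖ < n ∧ N.exp (s : N.Model) = g := by
    intro n
    obtain ⟨W, hWo, hW⟩ := isOpen_induced_iff.1 (hopen (Metric.ball (0 : z) n) Metric.isOpen_ball)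
    refine ⟨W, hWo, fun g => ⟨fun ⟨hgW, hgK⟩ => ?_, ?_⟩⟩
    · rw [← hKr] at hgK
      have h : (⟨g, hgK⟩ : (expHom hz).range) ∈ Subtype.val ⁻¹' W := hgW
      rw [hW] at h
      obtain ⟨s, hs, h⟩ := h
      exact ⟨s, mem_ball_zero_iff.1 hs, congrArg Subtype.val h⟩
    · rintro ⟨s, hs, rfl⟩
      have h : (expHom hz).rangeRestrict (.ofAdd s) ∈ Subtype.val ⁻¹' W := by
        rw [hW]
        exact ⟨s, mem_ball_zero_iff.2 hs, rfl⟩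
      exact ⟨h, hmem s⟩
  choose W hWo hW using hW
  have hcomp : IsCompact (N.toSpace '' K) := by
    refine IsClosed.isCompact ?_
    rw [← N.isOpenQuotientMap_toSpace.isQuotientMap.isClosed_preimage]
    convert hΓK using 1
    ext g
    simp only [Set.mem_preimage, Set.mem_image, Set.mem_ofPred_eq]
    constructor
    · rintro ⟨k, hk, h⟩
      rw [eq_comm, toSpace_eq_iff] at h
      exact ⟨_, h, by simpa using hk⟩
    · rintro ⟨γ, hγ, h⟩
      exact ⟨_, h, by rw [eq_comm, toSpace_eq_iff]; simpa using hγ⟩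
  obtain ⟨F, hF⟩ := hcomp.elim_finite_subcover (fun n => N.toSpace '' (W n ∩ U))
    (fun n => N.isOpenQuotientMap_toSpace.isOpenMap _ ((hWo n).inter hU)) (by
      rintro _ ⟨k, hk, rfl⟩
      obtain ⟨V, hV, rfl⟩ := hK ▸ hk
      obtain ⟨n, hn⟩ := exists_nat_gt ‖(⟨V, hV⟩ : z)‖
      exact Set.mem_iUnion.2 ⟨n, _, ⟨((hW n _).2 ⟨⟨V, hV⟩, hn, rfl⟩).1, hKU hk⟩, rfl⟩)
  refine ⟨(F.sup id : ℕ), fun t => ?_⟩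
  obtain ⟨n, hn, w, ⟨hw, hwU⟩, hwt⟩ : ∃ n ∈ F, N.toSpace (N.exp (t : N.Model)) ∈
      N.toSpace '' (W n ∩ U) := by simpa using hF ⟨_, hmem t, rfl⟩
  rw [toSpace_eq_iff] at hwt
  obtain ⟨s, hs, rfl⟩ := (hW n w).1 ⟨hw, hUK w hwU _ hwt (by simpa using hmem t)⟩
  refine ⟨s, hs.le.trans (Nat.cast_le.2 (Finset.le_sup (f := id) hn)), ?_⟩
  have h := exp_add_of_mem hz (t - s) s
  rw [sub_add_cancel] at h
  simpa [h] using hwt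

end Nilmanifold

/-! ### Decomposition into weights -/

namespace Nilmanifold

open Filter Topology MeasureTheory

/-- A function has weight `v` if right translation by `exp t` multiplies it by `e^{2πi⟨v, t⟩}`. -/
def HasWeight {N : Nilmanifold.{u}} {z : Submodule ℝ N.LieAlg} (v : N.dualLattice z)
    (f : C(N.Space, ℂ)) : Prop :=
  ∀ (x : N.Space) (t : z), f (N.act x (N.exp (t : N.LieAlg))) =
    f x * Complex.exp (2 * Real.pi * Complex.I * (((v : Module.Dual ℝ z) t : ℝ) : ℂ))

/-- The linear form underlying an element of the dual lattice. -/
def dualForm {N : Nilmanifold.{u}} {z : Submodule ℝ N.Model} (v : N.dualLattice z) :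
    z →ₗ[ℝ] ℝ := v.1

theorem hasWeight_iff {N : Nilmanifold.{u}} {z : Submodule ℝ N.Model} {v : N.dualLattice z}
    {f : C(N.Space, ℂ)} : HasWeight v f ↔ ∀ (x : N.Space) (t : z),
      f (N.act x (N.exp (t : N.Model))) =
        f x * Complex.exp (2 * Real.pi * Complex.I * ((dualForm v t : ℝ) : ℂ)) := Iff.rfl

variable {N : Nilmanifold.{u}} {z : Submodule ℝ N.Model}
  (hz : ∀ V ∈ z, IsBiInvariant (E := N.Model) N.G V) {d : ℕ} (b : Module.Basis (Fin d) ℝ z)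
  (hb : ∀ t : z, N.exp (t : N.Model) ∈ N.Γ ↔ ∀ i, ∃ n : ℤ, b.repr t i = n)
include hz hb

/-- The action of `exp t` depends only on the class of `t` modulo the lattice, since the elements of
the lattice are central in `G` and lie in `Γ`. -/
theorem act_exp_eq_of_toUnitAddTorus_eq (x : N.Space) {s t : z}
    (h : toUnitAddTorus (b.repr s) = toUnitAddTorus (b.repr t)) :
    N.act x (N.exp (s : N.Model)) = N.act x (N.exp (t : N.Model)) := by
  have h1 : N.exp ((s - t : z) : N.Model) ∈ N.Γ :=
    (hb _).2 fun i => by simpa using toUnitAddTorus_eq_iff.1 h i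
  have h2 := exp_add_of_mem hz (s - t) t
  rw [sub_add_cancel] at h2
  rw [h2, ← act_act, N.act_of_mem x h1 (exp_mul_comm hz _)]

/-- The torus `z / Λ`, acting on `Γ \ G` through the exponential map. The elements of the family are
given by an arbitrary choice of representatives. -/
noncomputable def torusFamily : CentralFamily N (UnitAddTorus (Fin d)) where
  toFun θ := N.exp ((b.equivFun.symm
    (Function.surjInv isOpenQuotientMap_toUnitAddTorus.surjective θ) : z) : N.Model)
  central θ := exp_mul_comm hz _
  continuous_act := by
    have h := (IsOpenQuotientMap.id (X := N.Space)).prodMap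
      (isOpenQuotientMap_toUnitAddTorus (ι := Fin d))
    rw [h.isQuotientMap.continuous_iff]
    have h1 : Continuous fun p : N.Space × (Fin d → ℝ) =>
        N.act p.1 (N.exp ((b.equivFunL.symm p.2 : z) : N.Model)) :=
      N.continuous_act.comp (continuous_fst.prodMk ((continuous_exp_coe hz).comp
        (b.equivFunL.symm.continuous.comp continuous_snd)))
    refine h1.congr fun p => ?_
    refine (act_exp_eq_of_toUnitAddTorus_eq hz b hb p.1 ?_).symm
    have h2 := Function.surjInv_eq isOpenQuotientMap_toUnitAddTorus.surjective
      (toUnitAddTorus p.2)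
    have h3 : ∀ t : Fin d → ℝ, ⇑(b.repr (b.equivFun.symm t)) = t := fun t =>
      b.equivFun.apply_symm_apply t
    exact (congrArg toUnitAddTorus (h3 _)).trans
      (h2.trans (congrArg toUnitAddTorus (h3 p.2)).symm)

theorem act_torusFamily (x : N.Space) (t : z) :
    N.act x ((torusFamily hz b hb).toFun (toUnitAddTorus (b.repr t))) =
      N.act x (N.exp (t : N.Model)) := by
  refine act_exp_eq_of_toUnitAddTorus_eq hz b hb x ?_
  have h2 := Function.surjInv_eq isOpenQuotientMap_toUnitAddTorus.surjective
    (toUnitAddTorus (b.repr t))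
  have h3 : ∀ t : Fin d → ℝ, ⇑(b.repr (b.equivFun.symm t)) = t := fun t =>
    b.equivFun.apply_symm_apply t
  exact (congrArg toUnitAddTorus (h3 _)).trans h2

theorem act_act_torusFamily (x : N.Space) (t : z) (θ : UnitAddTorus (Fin d)) :
    N.act (N.act x (N.exp (t : N.Model))) ((torusFamily hz b hb).toFun θ) =
      N.act x ((torusFamily hz b hb).toFun (θ + toUnitAddTorus (b.repr t))) := by
  obtain ⟨s, rfl⟩ := isOpenQuotientMap_toUnitAddTorus.surjective θ
  obtain ⟨s, rfl⟩ := b.equivFun.surjective s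
  have h : toUnitAddTorus (b.equivFun s) + toUnitAddTorus (b.repr t) =
      toUnitAddTorus (b.repr (t + s)) := by
    funext i
    simp [toUnitAddTorus, add_comm]
  rw [h, act_torusFamily, exp_add_of_mem hz, ← act_act]
  exact act_torusFamily hz b hb _ s

/-- The element `-∑ mᵢ bᵢ*` of the dual lattice. -/
noncomputable def torusWeight (m : Fin d → ℤ) : N.dualLattice z :=
  ⟨coordForm b fun i => -(m i : ℝ), by
    intro t ht
    choose n hn using (hb t).1 ht
    refine ⟨∑ i, -m i * n i, (coordForm_apply b _ t).trans ?_⟩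
    simp [hn]⟩

omit hz in
theorem dualForm_torusWeight (m : Fin d → ℤ) (t : z) :
    dualForm (torusWeight b hb m) t = ∑ i, -(m i : ℝ) * b.repr t i :=
  coordForm_apply b _ t

/-- The measure by which functions on the torus are averaged: the normalised Haar measure. -/
noncomputable abbrev torusMeasure (d : ℕ) : Measure (UnitAddTorus (Fin d)) :=
  Measure.pi fun _ => AddCircle.haarAddCircle

/-- Averaging against a monomial projects to a weight space, by translation invariance of the Haar
measure. -/
theorem hasWeight_avg_torusFamily (m : Fin d → ℤ) (f : C(N.Space, ℂ)) :
    HasWeight (torusWeight b hb m)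
      ((torusFamily hz b hb).avg (torusMeasure d) (UnitAddTorus.mFourier m) f) := by
  rw [hasWeight_iff]
  intro x t
  simp only [CentralFamily.avg_apply, act_act_torusFamily]
  set τ := toUnitAddTorus (b.repr t) with hτ
  have h1 := integral_add_right_eq_self (μ := torusMeasure d)
    (fun θ => UnitAddTorus.mFourier m (θ - τ) * f (N.act x ((torusFamily hz b hb).toFun θ))) τ
  simp only [add_sub_cancel_right] at h1
  rw [h1, ← integral_mul_const]
  congr 1 with θ
  have h2 : -τ = toUnitAddTorus (-b.repr t) := by
    funext i
    simp [hτ, toUnitAddTorus]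
  have h3 : UnitAddTorus.mFourier m (-τ) = Complex.exp (2 * Real.pi * Complex.I *
      ((dualForm (torusWeight b hb m) t : ℝ) : ℂ)) := by
    rw [h2, mFourier_toUnitAddTorus, dualForm_torusWeight]
    simp
  rw [sub_eq_add_neg, mFourier_add_apply, h3]
  ring

omit hb in
/-- Every smooth function is approximated, together with finitely many of its derivatives, by a
finite sum of smooth functions of given weights: its averages against a trigonometric polynomial on
`z / Λ` that is close to an approximate identity. -/
theorem exists_weight_decomposition {R : ℝ}
    (hR : ∀ t : z, ∃ s : z, ‖s‖ ≤ R ∧ N.exp ((t - s : z) : N.Model) ∈ N.Γ)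
    (L : Finset (List N.Model)) (f : N.smoothSubmodule) {ε : ℝ} (hε : 0 < ε) :
    ∃ c : N.dualLattice z →₀ N.smoothSubmodule, (∀ v, HasWeight v (c v).1) ∧
      ∀ l ∈ L, ‖(smoothIterDeriv l ((c.sum fun _ g => g) - f)).1‖ < ε := by
  classical
  obtain ⟨d, b, hb⟩ := exists_lattice_basis hz hR
  set a := torusFamily hz b hb
  obtain ⟨χ, hχ, happ⟩ := a.exists_avg_approx (torusMeasure d)
    _ UnitAddTorus.span_mFourier_closure_eq_top (θ₀ := toUnitAddTorus (b.repr (0 : z)))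
    (fun x => by
      rw [act_torusFamily]
      exact N.act_of_mem x ((hb 0).2 fun i => ⟨0, by simp⟩) (exp_mul_comm hz 0))
    (L.image fun l => (smoothIterDeriv l f).1) hε
  obtain ⟨w, rfl⟩ := Finsupp.mem_span_range_iff_exists_finsupp.1 hχ
  set χ := w.sum fun m k => k • UnitAddTorus.mFourier m with hχdef
  set g : (Fin d → ℤ) → N.smoothSubmodule := fun m =>
    w m • a.smoothAvg (torusMeasure d) (UnitAddTorus.mFourier m) f with hg
  set c : N.dualLattice z →₀ N.smoothSubmodule :=
    ∑ m ∈ w.support, Finsupp.single (torusWeight b hb m) (g m) with hc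
  have hsum : (c.sum fun _ g => g) = a.smoothAvg (torusMeasure d) χ f := by
    have h1 : (c.sum fun _ g => g) = ∑ m ∈ w.support, g m := by
      have h2 := map_sum (Finsupp.liftAddHom (M := N.smoothSubmodule)
        fun _ : N.dualLattice z => AddMonoidHom.id N.smoothSubmodule)
        (fun m => Finsupp.single (torusWeight b hb m) (g m)) w.support
      simp only [Finsupp.liftAddHom_apply_single, AddMonoidHom.id_apply] at h2
      exact h2
    rw [h1]
    apply Subtype.ext
    have h3 := map_sum (a.avgLinear (torusMeasure d) f.1)
      (fun m => w m • UnitAddTorus.mFourier m) w.support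
    simp only [map_smul] at h3
    rw [AddSubmonoidClass.coe_finsetSum]
    exact h3.symm
  refine ⟨c, fun v => ?_, fun l hl => ?_⟩
  · rw [hc]
    refine Finset.sum_induction _ (fun c : N.dualLattice z →₀ N.smoothSubmodule =>
      HasWeight v (c v).1) (fun c c' h h' x t => ?_) (fun x t => ?_) fun m _ => ?_
    · have := congrArg₂ (· + ·) (h x t) (h' x t)
      simpa [add_mul] using this
    · simp
    · rw [Finsupp.single_apply]
      split_ifs with hv
      · intro x t
        have := congrArg (w m * ·) (hasWeight_avg_torusFamily hz b hb m f.1 x t)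
        rw [hv, ← mul_assoc] at this
        exact this
      · intro x t
        simp
  · rw [hsum, map_sub, a.smoothIterDeriv_smoothAvg]
    exact happ _ (Finset.mem_image_of_mem _ hl)

end Nilmanifold

/-! ### Submersive homomorphisms -/

section Submersion

open Filter Topology

variable {E E' : Type*} [NormedAddCommGroup E] [NormedSpace ℝ E] [NormedAddCommGroup E']
  [NormedSpace ℝ E'] {G G' : Type*} [TopologicalSpace G] [ChartedSpace E G] [Group G]
  [LieGroup 𝓘(ℝ, E) ∞ G] [TopologicalSpace G'] [ChartedSpace E' G'] [Group G']
  [LieGroup 𝓘(ℝ, E') ∞ G'] {p : G →* G'} (hp : ContMDiff 𝓘(ℝ, E) 𝓘(ℝ, E') ∞ p)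
include hp

theorem modelDeriv_hom_leftField (V : E) (g : G) :
    modelDeriv E E' p g (leftField V g) = leftField (modelDeriv E E' p 1 V) (p g) := by
  have hd : MDifferentiable 𝓘(ℝ, E) 𝓘(ℝ, E') p := hp.mdifferentiable (by simp)
  have h1 := modelDeriv_comp (E := E) (E' := E) (E'' := E') (g := p) (f := (g * ·)) (x := (1 : G))
    (y := g) (mul_one g) (hd g) (mdiffAt_mul_left g 1)
  have h2 := modelDeriv_comp (E := E) (E' := E') (E'' := E') (g := (p g * ·)) (f := p)
    (x := (1 : G)) (y := 1) (map_one p) (mdiffAt_mul_left (p g) 1) (hd 1)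
  simp only [map_mul] at h1
  have h4 := congrArg (fun L => L V) (h1.symm.trans h2)
  exact h4

/-- Pull-back along a homomorphism turns the field of `dp V` into the field of `V`. -/
theorem leftDeriv_comp_hom {h : G' → ℂ} (hh : MDifferentiable 𝓘(ℝ, E') 𝓘(ℝ, ℂ) h) (V : E) (g : G) :
    leftDeriv V (fun x => h (p x)) g = leftDeriv (modelDeriv E E' p 1 V) h (p g) := by
  have hd : MDifferentiable 𝓘(ℝ, E) 𝓘(ℝ, E') p := hp.mdifferentiable (by simp)
  have h1 := modelDeriv_comp (E := E) (E' := E') (E'' := ℂ) (g := h) (f := p) (x := g) rfl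
    (hh (p g)) (hd g)
  rw [leftDeriv, leftDeriv, ← modelDeriv_hom_leftField hp]
  exact congrArg (fun L => L (leftField V g)) h1

/-- A homomorphism of Lie groups with surjective derivative has smooth local sections; here in the
canonical charts. -/
theorem exists_local_section [FiniteDimensional ℝ E] [FiniteDimensional ℝ E']
    (hs : Function.Surjective (modelDeriv E E' p (1 : G))) :
    ∃ σ : E' → E, σ (unitCoord E' G') = unitCoord E G ∧ ContDiffAt ℝ ∞ σ (unitCoord E' G') ∧
      ∀ᶠ v in 𝓝 (unitCoord E' G'), p (unitChartSymm G (σ v)) = unitChartSymm G' v := by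
  have : CompleteSpace E' := FiniteDimensional.complete ℝ E'
  have hd : MDifferentiable 𝓘(ℝ, E) 𝓘(ℝ, E') p := hp.mdifferentiable (by simp)
  obtain ⟨S, hS⟩ := (modelDeriv E E' p (1 : G)).toLinearMap.exists_rightInverse_of_surjective
    (LinearMap.range_eq_top.2 hs)
  set S' : E' →L[ℝ] E := LinearMap.toContinuousLinearMap S
  set ι : E' → E := fun w => unitCoord E G + S' w with hι
  have hι0 : ι 0 = unitCoord E G := by simp [hι]
  set ψ : E' → E' := fun w => unitChart E' (p (unitChartSymm G (ι w))) with hψ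
  have hψ0 : ψ 0 = unitCoord E' G' := by
    simp only [hψ, hι0, unitChartSymm_unitCoord, map_one]
    rfl
  have hsmooth : ContMDiffAt 𝓘(ℝ, E') 𝓘(ℝ, E') ∞ ψ 0 := by
    refine ContMDiffAt.comp (0 : E') (g := unitChart E') (I' := 𝓘(ℝ, E')) ?_ ?_
    · simpa [hι0] using contMDiffAt_unitChart_one
    · refine hp.contMDiffAt.comp (0 : E') (ContMDiffAt.comp (0 : E') (g := unitChartSymm G)
        (I' := 𝓘(ℝ, E)) ?_ ?_)
      · rw [hι0]
        exact contMDiffAt_unitChartSymm unitCoord_mem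
      · exact (contDiff_const.add S'.contDiff).contDiffAt.contMDiffAt
  have hψs : ContDiffAt ℝ ∞ ψ 0 := hsmooth.contDiffAt
  have hderiv : HasFDerivAt ψ
      ((ContinuousLinearEquiv.refl ℝ E' : E' ≃L[ℝ] E') : E' →L[ℝ] E') 0 := by
    have h1 : HasFDerivAt ι S' 0 := S'.hasFDerivAt.const_add _
    have h2 := (hψs.differentiableAt (by simp)).hasFDerivAt
    convert h2 using 1
    rw [← modelDeriv_eq_fderiv]
    have hu : MDifferentiableAt 𝓘(ℝ, E) 𝓘(ℝ, E) (unitChartSymm G) (unitCoord E G) :=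
      (contMDiffAt_unitChartSymm unitCoord_mem).mdifferentiableAt (by simp)
    have hc : MDifferentiableAt 𝓘(ℝ, E') 𝓘(ℝ, E') (unitChart E') (1 : G') :=
      contMDiffAt_unitChart_one.mdifferentiableAt (by simp)
    have hi : MDifferentiableAt 𝓘(ℝ, E') 𝓘(ℝ, E) ι 0 := h1.differentiableAt.mdifferentiableAt
    have e1 := modelDeriv_comp (E := E') (E' := E) (E'' := E) (g := unitChartSymm G) (f := ι)
      (x := (0 : E')) hι0 hu hi
    have hui : MDifferentiableAt 𝓘(ℝ, E') 𝓘(ℝ, E) (fun w => unitChartSymm G (ι w)) 0 :=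
      MDifferentiableAt.comp (0 : E') (by rw [hι0]; exact hu) hi
    have e2 := modelDeriv_comp (E := E') (E' := E) (E'' := E') (g := p)
      (f := fun w => unitChartSymm G (ι w)) (x := (0 : E')) (y := 1) (by simp [hι0]) (hd 1) hui
    have e3 := modelDeriv_comp (E := E') (E' := E') (E'' := E') (g := unitChart E')
      (f := fun w => p (unitChartSymm G (ι w))) (x := (0 : E')) (y := 1) (by simp [hι0]) hc
      (MDifferentiableAt.comp (0 : E') (hd _) hui)
    have e4 : modelDeriv E' E ι 0 = S' := (modelDeriv_eq_fderiv ι 0).trans h1.fderiv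
    rw [e3, e2, e1, e4, modelDeriv_unitChart_one, modelDeriv_unitChartSymm_unitCoord]
    ext w
    exact (LinearMap.congr_fun hS w).symm
  set τ := hψs.localInverse hderiv (by simp) with hτ
  have hτs : ContDiffAt ℝ ∞ τ (ψ 0) := hψs.to_localInverse hderiv (by simp)
  have hτ0 : τ (ψ 0) = 0 := hψs.localInverse_apply_image hderiv (by simp)
  rw [hψ0] at hτs hτ0
  have hτr : ∀ᶠ v in 𝓝 (unitCoord E' G'), ψ (τ v) = v := by
    have := (hψs.hasStrictFDerivAt' hderiv (by simp)).eventually_right_inverse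
    rwa [hψ0] at this
  refine ⟨fun v => ι (τ v), (congrArg ι hτ0).trans hι0, contDiffAt_const.add
    (S'.contDiff.contDiffAt.comp _ hτs), ?_⟩
  have h1 : Tendsto (fun v => p (unitChartSymm G (ι (τ v)))) (𝓝 (unitCoord E' G')) (𝓝 1) := by
    have hc : ContinuousAt (fun w => p (unitChartSymm G (ι w))) (τ (unitCoord E' G')) := by
      rw [hτ0]
      refine hp.continuous.continuousAt.comp (ContinuousAt.comp (g := unitChartSymm G) ?_ ?_)
      · rw [hι0]
        exact continuousAt_unitChartSymm unitCoord_mem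
      · exact (continuous_const.add S'.continuous).continuousAt
    have hc' := (hc.comp (f := τ) hτs.continuousAt).tendsto
    have h0 : ((fun w => p (unitChartSymm G (ι w))) ∘ τ) (unitCoord E' G') = 1 := by
      simp [hτ0, hι0]
    rwa [h0] at hc'
  have h2 : ∀ᶠ y in 𝓝 (1 : G'), unitChartSymm G' (unitChart E' y) = y := by
    have := eventually_unitChartSymm_unitChart (G := G') (unitCoord_mem (E := E'))
    simpa using this
  filter_upwards [hτr, h1.eventually h2] with v hv hv'
  exact hv'.symm.trans (congrArg (unitChartSymm G') hv)

/-- Smoothness of a function descends along a surjective homomorphism of Lie groups with surjective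
derivative. -/
theorem contMDiff_of_comp_hom [FiniteDimensional ℝ E] [FiniteDimensional ℝ E']
    (hs : Function.Surjective (modelDeriv E E' p (1 : G))) (hsurj : Function.Surjective p)
    {h : G' → ℂ} (hh : ContMDiff 𝓘(ℝ, E) 𝓘(ℝ, ℂ) ∞ fun x => h (p x)) :
    ContMDiff 𝓘(ℝ, E') 𝓘(ℝ, ℂ) ∞ h := by
  intro y
  obtain ⟨g, rfl⟩ := hsurj y
  obtain ⟨σ, hσ0, hσ, hσp⟩ := exists_local_section hp hs
  rw [contMDiffAt_iff_unitChartSymm le_rfl]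
  have h1 : ContMDiffAt 𝓘(ℝ, E') 𝓘(ℝ, ℂ) ∞ (fun v => h (p (g * unitChartSymm G (σ v))))
      (unitCoord E' G') := by
    refine hh.contMDiffAt.comp (unitCoord E' G') ((contMDiff_mul_left (a := g)).contMDiffAt.comp
      (unitCoord E' G') (ContMDiffAt.comp (unitCoord E' G') (g := unitChartSymm G) (I' := 𝓘(ℝ, E))
        ?_ hσ.contMDiffAt))
    rw [hσ0]
    exact contMDiffAt_unitChartSymm unitCoord_mem
  refine h1.congr_of_eventuallyEq ?_
  filter_upwards [hσp] with v hv
  rw [map_mul, hv]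

end Submersion

/-! ### Pull-back along a projection -/

namespace Nilmanifold

open Filter Topology

namespace Projection

variable {N N' : Nilmanifold.{u}} {z : Submodule ℝ N.LieAlg} (p : Projection N N' z)

/-- The derivative of a projection, as a map of model spaces. -/
noncomputable def deriv : N.Model →L[ℝ] N'.Model := modelDeriv N.Model N'.Model p.hom 1

theorem surjective_deriv : Function.Surjective p.deriv := p.deriv_surjective

theorem toMap_toSpace (g : N.G) : p.toMap (N.toSpace g) = N'.toSpace (p.hom g) := rfl

theorem toMap_act (x : N.Space) (g : N.G) : p.toMap (N.act x g) = N'.act (p.toMap x) (p.hom g) := by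
  obtain ⟨y, rfl⟩ := N.isOpenQuotientMap_toSpace.surjective x
  simp [toMap_toSpace]

theorem hom_exp {t : N.LieAlg} (ht : t ∈ z) : p.hom (N.exp t) = 1 := by
  have h : N.exp t ∈ (p.hom.ker : Set N.G) := by
    rw [p.ker_hom]
    exact ⟨t, ht, rfl⟩
  exact h

theorem toMap_act_exp (x : N.Space) (t : z) :
    p.toMap (N.act x (N.exp (t : N.LieAlg))) = p.toMap x := by
  rw [p.toMap_act, p.hom_exp t.2]
  obtain ⟨y, hy⟩ := N'.isOpenQuotientMap_toSpace.surjective (p.toMap x)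
  rw [← hy, act_toSpace, mul_one]

/-- The pull-back of smooth functions along a projection. -/
noncomputable def pullback : N'.smoothSubmodule →ₗ[ℂ] N.smoothSubmodule where
  toFun f := ⟨f.1.comp p.toMap, (contMDiff_toSpace f).comp p.smooth⟩
  map_add' _ _ := rfl
  map_smul' _ _ := rfl

theorem norm_pullback_le (f : N'.smoothSubmodule) : ‖(p.pullback f).1‖ ≤ ‖f.1‖ :=
  (ContinuousMap.norm_le _ (norm_nonneg _)).2 fun x => f.1.norm_coe_le_norm (p.toMap x)

theorem smoothDeriv_pullback (V : N.Model) (f : N'.smoothSubmodule) :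
    smoothDeriv V (p.pullback f) = p.pullback (smoothDeriv (p.deriv V) f) := by
  ext x
  obtain ⟨y, rfl⟩ := N.isOpenQuotientMap_toSpace.surjective x
  exact leftDeriv_comp_hom p.smooth (mdifferentiable_toSpace f) V y

theorem smoothIterDeriv_pullback (l : List N.Model) (f : N'.smoothSubmodule) :
    smoothIterDeriv l (p.pullback f) = p.pullback (smoothIterDeriv (l.map p.deriv) f) := by
  induction l with
  | nil => rfl
  | cons V l ih =>
    rw [smoothIterDeriv_cons, ih, smoothDeriv_pullback]
    rfl

/-- A smooth function invariant under `exp z` descends along the projection. -/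
theorem exists_pullback_eq (f : N.smoothSubmodule)
    (hf : ∀ (x : N.Space) (t : z), f.1 (N.act x (N.exp (t : N.LieAlg))) = f.1 x) :
    ∃ f' : N'.smoothSubmodule, p.pullback f' = f := by
  set F : N'.G → ℂ := fun y => f.1 (N.toSpace (Function.surjInv p.surjective y)) with hF
  have hFp : ∀ g, F (p.hom g) = f.1 (N.toSpace g) := by
    intro g
    set g' := Function.surjInv p.surjective (p.hom g) with hg'
    have h1 : g⁻¹ * g' ∈ (p.hom.ker : Set N.G) := by
      change p.hom (g⁻¹ * g') = 1
      rw [map_mul, map_inv, hg', Function.surjInv_eq p.surjective, inv_mul_cancel]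
    rw [p.ker_hom] at h1
    obtain ⟨t, ht, h1⟩ := h1
    have h2 := hf (N.toSpace g) ⟨t, ht⟩
    change f.1 (N.act (N.toSpace g) (N.exp t)) = _ at h2
    rw [h1, act_toSpace, mul_inv_cancel_left] at h2
    exact h2
  have hFs : ContMDiff (𝓡 N'.dim) 𝓘(ℝ, ℂ) ∞ F := by
    refine contMDiff_of_comp_hom p.smooth p.surjective_deriv p.surjective ?_
    simp only [hFp]
    exact contMDiff_toSpace f
  have hFΓ : ∀ a b, QuotientGroup.rightRel N'.Γ a b → F a = F b := by
    intro a b h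
    rw [QuotientGroup.rightRel_apply, ← p.map_lattice] at h
    obtain ⟨γ, hγ, h⟩ := h
    obtain ⟨x, rfl⟩ := p.surjective a
    have h1 : b = p.hom (γ * x) := by rw [map_mul, h, inv_mul_cancel_right]
    rw [h1, hFp, hFp]
    congr 1
    rw [toSpace_eq_iff]
    simpa using hγ
  refine ⟨⟨⟨Quotient.lift F hFΓ, hFs.continuous.quotient_lift _⟩, hFs⟩, ?_⟩
  ext x
  obtain ⟨y, rfl⟩ := N.isOpenQuotientMap_toSpace.surjective x
  exact hFp y

/-- The subgroup `Γ exp z` is the preimage of the discrete subgroup `Γ'`, so it is closed, and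
`exp z` is open in it. -/
theorem exists_relativelyDense {N N' : Nilmanifold.{u}} {z : Submodule ℝ N.Model}
    (p : Projection N N' z) (hz : ∀ V ∈ z, IsBiInvariant (E := N.Model) N.G V) :
    ∃ R : ℝ, ∀ t : z, ∃ s : z,
      ‖s‖ ≤ R ∧ N.exp ((t - s : z) : N.Model) ∈ N.Γ := by
  obtain ⟨O, hO, hO1⟩ := isOpen_induced_iff.1 (isOpen_discrete ({1} : Set N'.Γ))
  have hO1' : ∀ γ ∈ N'.Γ, γ ∈ O ↔ γ = 1 := by
    intro γ hγ
    have h := Set.ext_iff.1 hO1 ⟨γ, hγ⟩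
    simpa using h
  refine Nilmanifold.exists_relativelyDense hz (K := (p.hom.ker : Set N.G)) p.ker_hom
    ?_ ?_ (hO.preimage p.smooth.continuous) ?_ ?_
  · exact isClosed_singleton.preimage p.smooth.continuous
  · have h : {g | ∃ γ ∈ N.Γ, γ * g ∈ (p.hom.ker : Set N.G)} = p.hom ⁻¹' (N'.Γ : Set N'.G) := by
      ext g
      simp only [Set.mem_ofPred_eq, Set.mem_preimage, SetLike.mem_coe, MonoidHom.mem_ker, map_mul,
        ← p.map_lattice, Subgroup.mem_map]
      constructor
      · rintro ⟨γ, hγ, h⟩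
        exact ⟨γ⁻¹, inv_mem hγ, by rw [map_inv, inv_eq_of_mul_eq_one_right h]⟩
      · rintro ⟨γ, hγ, h⟩
        exact ⟨γ⁻¹, inv_mem hγ, by rw [map_inv, h, inv_mul_cancel]⟩
    rw [h]
    exact (Subgroup.isClosed_of_discrete (H := N'.Γ)).preimage p.smooth.continuous
  · intro g hg
    have : p.hom g = 1 := hg
    simp [this, (hO1' 1 (one_mem _)).2 rfl]
  · intro g hg γ hγ h
    have h1 : p.hom γ * p.hom g = 1 := by simpa using h
    have h2 : p.hom g = (p.hom γ)⁻¹ := eq_inv_of_mul_eq_one_right h1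
    have h3 : p.hom g ∈ N'.Γ := by
      rw [h2, ← p.map_lattice]
      exact inv_mem (Subgroup.mem_map_of_mem _ hγ)
    exact (hO1' _ h3).1 hg

end Projection

/-! ### Density of trigonometric polynomials -/

/-- A finite sum of smooth functions of given weights is a trigonometric polynomial. -/
theorem isRelTrigPoly_sum {N : Nilmanifold.{u}} {z : Submodule ℝ N.LieAlg}
    (c : N.dualLattice z →₀ N.smoothSubmodule) (hc : ∀ v, HasWeight v (c v).1) :
    N.IsRelTrigPoly z (c.sum fun _ g => g).1 (c 0).1 := by
  refine ⟨c.mapRange Subtype.val rfl, by simp, fun x t => ?_⟩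
  rw [Finsupp.sum_mapRange_index (by simp), Finsupp.sum, AddSubmonoidClass.coe_finsetSum,
    ContinuousMap.sum_apply]
  exact Finset.sum_congr rfl fun v _ => hc v x t

/-- Every smooth function is approximated by smooth functions in a given set, together with any
finite number of derivatives. -/
def SmoothlyDense {N : Nilmanifold.{u}} (S : Set C(N.Space, ℂ)) : Prop :=
  ∀ (f : N.smoothSubmodule) (L : Finset (List N.Model)) (ε : ℝ), 0 < ε →
    ∃ g : N.smoothSubmodule, g.1 ∈ S ∧ ∀ l ∈ L, ‖(smoothIterDeriv l (g - f)).1‖ < ε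

/-- Density passes from the quotient by `exp z` to `Γ \ G`: after decomposing into weights, the part
of weight `0` descends to the quotient, where it is approximated by an element of `S`. -/
theorem SmoothlyDense.of_projection {N N' : Nilmanifold.{u}} {z : Submodule ℝ N.LieAlg}
    (hz : z ≤ (LieAlgebra.center ℝ N.LieAlg).toSubmodule) (p : Projection N N' z)
    {S : Set C(N'.Space, ℂ)} (hS : SmoothlyDense S) :
    SmoothlyDense {f | ∃ φ ∈ S, N.IsRelTrigPoly z f (φ.comp p.toMap)} := by
  classical
  intro f L ε hε
  have hz' : ∀ V ∈ z, IsBiInvariant (E := N.Model) N.G V := fun V hV =>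
    N.isBiInvariant_of_mem_center (hz hV)
  obtain ⟨R, hR⟩ := Projection.exists_relativelyDense p hz'
  obtain ⟨c, hc, hcL⟩ := exists_weight_decomposition hz' hR L f (half_pos hε)
  obtain ⟨h, hh⟩ := Projection.exists_pullback_eq p (c 0) (fun x t => by
    have := hc 0 x t
    simpa using this)
  obtain ⟨φ, hφ, hφL⟩ := hS h (L.image (List.map (Projection.deriv p))) (ε / 2) (half_pos hε)
  set c' := c.update 0 (Projection.pullback p φ) with hc'
  have hc'w : ∀ v, HasWeight v (c' v).1 := by
    intro v
    by_cases hv : v = 0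
    · subst hv
      intro x t
      rw [hc', Finsupp.coe_update, Function.update_self]
      refine (congrArg φ.1 (Projection.toMap_act_exp p x t)).trans ?_
      simp only [ZeroMemClass.coe_zero, LinearMap.zero_apply, Complex.ofReal_zero, mul_zero,
        Complex.exp_zero, mul_one]
      rfl
    · rw [hc', Finsupp.coe_update, Function.update_of_ne hv]
      exact hc v
  refine ⟨c'.sum fun _ g => g, ⟨φ.1, hφ, ?_⟩, fun l hl => ?_⟩
  · have := isRelTrigPoly_sum c' hc'w
    rw [hc', Finsupp.coe_update, Function.update_self] at this
    exact this
  · have h1 := Finsupp.sum_update_add c 0 (Projection.pullback p φ)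
      (fun _ g => g) (fun _ => rfl) (fun _ _ _ => rfl)
    have h2 : (c'.sum fun _ g => g) - f =
        ((c.sum fun _ g => g) - f) + Projection.pullback p (φ - h) := by
      rw [map_sub, hh, hc', ← sub_eq_zero, ← sub_eq_zero.2 h1]
      abel
    rw [h2, map_add, Projection.smoothIterDeriv_pullback]
    refine (norm_add_le _ _).trans_lt ?_
    have h3 := (Projection.norm_pullback_le p _).trans_lt
      (hφL (l.map (Projection.deriv p)) (Finset.mem_image_of_mem _ hl))
    linarith [hcL l hl]

variable {N : Nilmanifold.{u}}

theorem exp_surjective_of_comm (hN : ∀ a b : N.G, a * b = b * a) (g : N.G) :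
    ∃ V : N.Model, N.exp V = g := by
  set b := Module.finBasis ℝ N.Model
  obtain ⟨t, ht⟩ := N.isExponential_exp.surjective_sum (v := b)
    (fun i => N.isBiInvariant_of_comm hN (b i)) b.span_eq g
  exact ⟨_, ht⟩

/-- On a torus, a function of a given weight is a multiple of a character. -/
theorem HasWeight.mem_torusTrigPoly (hN : ∀ a b : N.G, a * b = b * a)
    {v : N.dualLattice (⊤ : Submodule ℝ N.LieAlg)} {f : C(N.Space, ℂ)} (hf : HasWeight v f) :
    f ∈ N.torusTrigPoly := by
  set w := f (N.toSpace 1) with hw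
  -- the value at `g exp V` is the value at `g`, multiplied by a phase depending on `V` only
  have hphase : ∀ h : N.G, ∃ ζ : ℂ, ‖ζ‖ = 1 ∧ ∀ g, f (N.toSpace (g * h)) = f (N.toSpace g) * ζ := by
    intro h
    obtain ⟨V, rfl⟩ := exp_surjective_of_comm hN h
    refine ⟨_, ?_, fun g => hf (N.toSpace g) ⟨V, Submodule.mem_top⟩⟩
    rw [Complex.norm_exp]
    simp
  choose ζ hζ hfζ using hphase
  have hfw : ∀ g, f (N.toSpace g) = w * ζ g := fun g => by simpa using hfζ g 1
  by_cases hw0 : w = 0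
  · have : f = 0 := by
      ext x
      obtain ⟨g, rfl⟩ := N.isOpenQuotientMap_toSpace.surjective x
      simp [hfw, hw0]
    rw [this]
    exact Submodule.zero_mem _
  have hζf : ∀ g, ζ g = w⁻¹ * f (N.toSpace g) := fun g => by
    rw [hfw, inv_mul_cancel_left₀ hw0]
  have hmul : ∀ g h, ζ (g * h) = ζ g * ζ h := fun g h => by
    rw [hζf, hfζ, ← mul_assoc, ← hζf]
  let χ : N.G →ₜ* Circle :=
    { toFun := fun g => ⟨ζ g, mem_sphere_zero_iff_norm.2 (hζ g)⟩
      map_one' := Subtype.ext (by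
        change ζ 1 = 1
        rw [hζf, ← hw, inv_mul_cancel₀ hw0])
      map_mul' := fun g h => Subtype.ext (hmul g h)
      continuous_toFun := by
        refine Continuous.subtype_mk ?_ _
        rw [funext hζf]
        exact continuous_const.mul (f.continuous.comp N.isOpenQuotientMap_toSpace.continuous) }
  have hmem : w⁻¹ • f ∈ {e : C(N.Space, ℂ) | ∃ χ : N.G →ₜ* Circle,
      ∀ g : N.G, e (N.toSpace g) = χ g} := ⟨χ, fun g => (hζf g).symm⟩
  have h := Submodule.smul_mem _ w (Submodule.subset_span hmem)
  rwa [smul_inv_smul₀ hw0] at h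

/-- On a torus the weight decomposition with respect to the whole Lie algebra is a decomposition
into multiples of characters. -/
theorem smoothlyDense_torusTrigPoly (hN : ∀ a b : N.G, a * b = b * a) :
    SmoothlyDense N.torusTrigPoly := by
  intro f L ε hε
  have hz : ∀ V ∈ (⊤ : Submodule ℝ N.Model), IsBiInvariant (E := N.Model) N.G V :=
    fun V _ => N.isBiInvariant_of_comm hN V
  obtain ⟨R, hR⟩ := exists_relativelyDense hz (K := Set.univ)
    (by
      ext g
      exact ⟨fun _ => (exp_surjective_of_comm hN g).imp fun _ h => ⟨trivial, h⟩, fun _ => trivial⟩)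
    isClosed_univ (by convert isClosed_univ using 1; ext g; simpa using ⟨1, one_mem _⟩) isOpen_univ
    (Set.subset_univ _) (fun _ _ _ _ _ => Set.mem_univ _)
  obtain ⟨c, hc, hcL⟩ := exists_weight_decomposition hz hR L f hε
  refine ⟨c.sum fun _ g => g, ?_, hcL⟩
  rw [Finsupp.sum, AddSubmonoidClass.coe_finsetSum]
  exact Submodule.sum_mem _ fun v _ => (hc v).mem_torusTrigPoly hN

/-- The identification of `smoothSubmodule` with `SmoothFunction`. -/
def toSmoothFunction (f : N.smoothSubmodule) : N.SmoothFunction := ⟨f.1, f.2⟩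

/-- Approximation of finitely many derivatives suffices for density in `C^∞(Γ \ G)`, as each basic
neighbourhood in its topology involves finitely many derivatives only. -/
theorem SmoothlyDense.dense {S : Set C(N.Space, ℂ)} (hS : SmoothlyDense S) :
    Dense {f : N.SmoothFunction | f.1 ∈ S} := by
  intro f
  choose g hgS hg using fun q : Finset (List N.Model) × ℕ =>
    hS ⟨f.1, f.2⟩ q.1 (1 / ((q.2 : ℝ) + 1)) Nat.one_div_pos_of_nat
  refine mem_closure_of_tendsto (f := fun q => toSmoothFunction (g q))
    (b := atTop) ?_ (Eventually.of_forall hgS)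
  have hnhds : 𝓝 f = ⨅ l : List N.LieAlg, comap (fun f : N.SmoothFunction =>
      UniformFun.ofFun (N.iterDeriv l fun g => f.1 (N.toSpace g)))
      (𝓝 (UniformFun.ofFun (N.iterDeriv l fun g => f.1 (N.toSpace g)))) :=
    nhds_iInf.trans (iInf_congr fun l => nhds_induced _ _)
  rw [hnhds, tendsto_iInf]
  intro l
  rw [tendsto_comap_iff, UniformFun.tendsto_iff_tendstoUniformly,
    Metric.tendstoUniformly_iff]
  intro ε hε
  obtain ⟨n, hn⟩ := exists_nat_one_div_lt hε
  filter_upwards [eventually_ge_atTop ({l}, n)] with q hq x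
  have h1 := hg q l (hq.1 (Finset.mem_singleton_self l))
  have h2 : 1 / ((q.2 : ℝ) + 1) ≤ 1 / ((n : ℝ) + 1) :=
    one_div_le_one_div_of_le (by positivity) (by simpa using hq.2)
  have h3 := (smoothIterDeriv l (g q - ⟨f.1, f.2⟩)).1.norm_coe_le_norm (N.toSpace x)
  have h4 : (smoothIterDeriv l (g q - ⟨f.1, f.2⟩)).1 (N.toSpace x) =
      N.iterDeriv l (fun y => (g q).1 (N.toSpace y)) x -
        N.iterDeriv l (fun y => f.1 (N.toSpace y)) x := by
    have e1 := congrFun (iterDeriv_eq l (g q)) x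
    have e2 := congrFun (iterDeriv_eq l (⟨f.1, f.2⟩ : N.smoothSubmodule)) x
    rw [e1, e2, map_sub]
    rfl
  rw [h4] at h3
  rw [dist_comm, dist_eq_norm]
  exact (h3.trans_lt h1).trans (h2.trans_lt hn)

end Nilmanifold

theorem HeisenbergTower.smoothlyDense_trigPoly {N : Nilmanifold.{u}} {X : N.LieAlg} {h : ℕ}
    (T : HeisenbergTower N X h) (hT : T.IsMaximal) : Nilmanifold.SmoothlyDense T.trigPoly := by
  induction T with
  | base N X => exact Nilmanifold.smoothlyDense_torusTrigPoly hT
  | step Y Z z triple envelope p T ih => exact (ih hT).of_projection envelope.1.2.1 p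

theorem mainTheorem9 (M : Nilmanifold.{u}) (X : M.LieAlg)
    (hX : X ∉ LieModule.lowerCentralSeries ℝ M.LieAlg M.LieAlg 1)
    (h : ℕ) (T : HeisenbergTower M X h) (hT : T.IsMaximal) :
    Dense {f : M.SmoothFunction | f.1 ∈ T.trigPoly} :=
  (T.smoothlyDense_trigPoly hT).dense
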